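/- Let $E$ be an $n$-dimensional real vector space with dual $E^*$, and let $B:E\to E^*$ be a symmetric positive definite linear operator. Put $\|x\|=\langle Bx,x\rangle^{1/2}$ for $x\in E$ and $\|s\|_*=\langle s,B^{-1}s\rangle^{1/2}$ for $s\in E^*$. Let $f:E\to\mathbb R$ be differentiable and bounded below, $f^*=\inf_E f$, and suppose that for some $\nu\in[0,1]$, $L_\nu\ge 0$ $$\|\nabla f(y)-\nabla f(x)\|_*\le L_\nu\|y-x\|^\nu\qquad\text{for all }x,y\in E .$$ Let $\delta\ge 0$ and let $\tilde f(\cdot,\delta):E\to\mathbb R$ be a Borel function with $|f(x)-\tilde f(x,\delta)|\le\delta$ for all $x\in E$. For $\mu>0$ let $$f_\mu(x)=\frac1\kappa\int_E f(x+\mu u)e^{-\|u\|^2/2}\,du,\qquad \kappa=\int_E e^{-\|u\|^2/2}\,du,\qquad g_\mu(x,u,\delta)=\frac{\tilde f(x+\mu u,\delta)-\tilde f(x,\delta)}{\mu}\,Bu .$$ Call $(a_1,a_2)$ an admissible pair if either $$a_1=\frac{L_\nu}{\mu^{1-\nu}}\,n^{\frac{1+\nu}2},\quad a_2=0,$$ or,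 for some $\hat\delta>0$, $$a_1=\Big[\frac1{\hat\delta}\Big]^{\frac{1-\nu}{1+\nu}}\frac{2L_\nu}{\mu^{1-\nu}},\quad a_2=\hat\delta L_\nu\mu^{1+\nu}.$$ Let $(A_1,A_2)$ and $(A_1',A_2')$ be two admissible pairs, chosen independently of each other, with $A_1>0$. Let $D\in(0,1]$, $h=\dfrac{D}{80(n+4)A_1}$, $N\ge1$, $x_0\in E$, and $$x_{k+1}=x_k-hB^{-1}g_\mu(x_k,u_k,\delta),\qquad k=0,\dots,N-1,$$ where $u_0,\dots,u_{N-1}$ are i.i.d. standard Gaussian vectors of the Euclidean space $(E,\|\cdot\|)$, i.e. with density $\kappa^{-1}e^{-\|u\|^2/2}$; let $\mathbb E_{\mathcal U}$ be the expectation over $\mathcal U=(u_0,\dots,u_{N-1})$. Then the integral defining $f_\mu$ converges absolutely at every point, $f_\mu$ is differentiable, the expectations below are finite, and $$\begin{aligned}\min_{0\le k\le N-1}\mathbb E_{\mathcal U}\big[\|\nabla f_\mu(x_k)\|_*^2\big]\le{}&\frac{320(n+4)A_1\,(f_\mu(x_0)-f^*)}{ND}\\&+\frac{D}{4(n+4)}\Big(\frac{4\delta^2}{\mu^2}n+\frac{4L_\nu^2}{(1+\nu)^2}\mu^{2\nu}n^{2+\nu}+\frac{\mu^2(A_1')^2}{4}(n+6)^3+\frac{(A_2')^2}{\mu^2}n\Big)\\&+\frac{320(n+4)A_1}{D}\Big(A_2+\frac{\delta^2}{2A_1\mu^2}n+\frac{\delta^2}{\mu^2}n\Big).\end{aligned}$$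 -/

import Mathlib

open MeasureTheory ProbabilityTheory

noncomputable section

namespace ZerothOrder

/- `E` is a finite-dimensional real vector space; its Mathlib norm is an arbitrary one and only
serves to fix the (unique) vector space topology. The Euclidean structure is given by
`B : E → E*`, a linear bijection which the theorem assumes symmetric and positive definite. -/
variable {E : Type*} [NormedAddCommGroup E] [NormedSpace ℝ E]

/-- The Euclidean norm `‖x‖ = ⟨B x, x⟩ ^ (1/2)` on `E`. -/
def primalNorm (B : E ≃L[ℝ] StrongDual ℝ E) (x : E) : ℝ :=
  Real.sqrt (B x x)

/-- The dual Euclidean norm `‖s‖_* = ⟨s, B⁻¹ s⟩ ^ (1/2)` on `E*`. -/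
def dualNorm (B : E ≃L[ℝ] StrongDual ℝ E) (s : StrongDual ℝ E) : ℝ :=
  Real.sqrt (s (B.symm s))

/-- The unnormalized Gaussian weight `exp (-‖u‖² / 2)`. -/
def gaussWeight (B : E ≃L[ℝ] StrongDual ℝ E) (u : E) : ℝ :=
  Real.exp (-(1 / 2) * primalNorm B u ^ 2)

section Smoothing

variable [FiniteDimensional ℝ E] [MeasurableSpace E] [BorelSpace E]

/-- The normalizing constant `κ = ∫ exp (-‖u‖² / 2) du`. Here `du` is a fixed translation
invariant (Lebesgue) measure on `E`; its scaling cancels wherever `κ` is used below. -/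
def kappa (B : E ≃L[ℝ] StrongDual ℝ E) : ℝ :=
  ∫ u : E, gaussWeight B u ∂Measure.addHaar

/-- The Gaussian approximation `f_μ(x) = κ⁻¹ ∫ f(x + μ u) exp (-‖u‖² / 2) du`. -/
def smoothed (B : E ≃L[ℝ] StrongDual ℝ E) (f : E → ℝ) (μ : ℝ) (x : E) : ℝ :=
  1 / kappa B * ∫ u : E, f (x + μ • u) * gaussWeight B u ∂Measure.addHaar

/-- The law of a standard Gaussian vector of the Euclidean space `(E, B)`: the measure with
density `κ⁻¹ exp (-‖u‖² / 2)`. -/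
def stdGaussianLaw (B : E ≃L[ℝ] StrongDual ℝ E) : Measure E :=
  Measure.addHaar.withDensity fun u => ENNReal.ofReal (1 / kappa B * gaussWeight B u)

end Smoothing

/-- The random gradient estimate `g_μ(x, u, δ) = (f̃(x + μ u, δ) - f̃(x, δ)) / μ · B u ∈ E*`;
`ftilde` is the function `f̃(·, δ)`. -/
def gradEst (B : E ≃L[ℝ] StrongDual ℝ E) (ftilde : E → ℝ) (μ : ℝ) (x u : E) :
    StrongDual ℝ E :=
  ((ftilde (x + μ • u) - ftilde x) / μ) • B u

/-- `(A₁, A₂)` is one of the two admissible pairs of constants in the quadratic-with-slack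
bound for `f_μ`, in dimension `n`, with Hölder data `(ν, L)` and smoothing parameter `μ`. -/
def IsSlackPair (n : ℕ) (ν L μ A₁ A₂ : ℝ) : Prop :=
  (A₁ = L / μ ^ (1 - ν) * (n : ℝ) ^ ((1 + ν) / 2) ∧ A₂ = 0) ∨
  ∃ δhat : ℝ, 0 < δhat ∧
    A₁ = (1 / δhat) ^ ((1 - ν) / (1 + ν)) * (2 * L / μ ^ (1 - ν)) ∧
    A₂ = δhat * L * μ ^ (1 + ν)

end ZerothOrder

end

/-!
A linear isometry carries the Euclidean structure `B` to a Euclidean space `F`, where `f_μ(x)` is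
the expectation of `f(x + μ u)` for a standard Gaussian vector `u`.

Gaussian integration by parts gives `μ ⟨∇f_μ(x), e⟩ = E ⟨e, u⟩ f(x + μ u)`. Differentiating this
once more under the integral, the Hölder bound on `∇f` makes `∇f_μ` Lipschitz; alternatively `∇f_μ`
inherits the Hölder bound, and Young's inequality trades the power `1 + ν` for a square. Hence each
admissible pair satisfies `|f_μ(y) - f_μ(x) - ⟨∇f_μ(x), y - x⟩| ≤ A₁ / 2 ‖y - x‖² + A₂`.

With `(A₁, A₂)` this bounds the expected value of `f_μ` after one step, up to the correlation of the
gradient estimate with `∇f_μ(x)`, which is at least `3 / 4 ‖∇f_μ(x)‖² - 4 δ² n / μ²`, and its second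
moment. With `(A₁', A₂')` and the Gaussian moments of order two, four and six, the second moment is
at most `5 (n + 2) ‖∇f_μ(x)‖²` plus a constant. The step size lets the first term be absorbed, so
`E f_μ` drops by `h / 4 E ‖∇f_μ(x_k)‖²` up to a constant error; since `x_k` is independent of `u_k`,
this can be iterated, and summing over `k` and using `f_μ ≥ f*` gives the bound.
-/

open scoped NNReal ENNReal

namespace ZerothOrder

section FiniteMoments

variable {Ω : Type*} [MeasurableSpace Ω] {P : Measure Ω}
variable {G : Type*} [NormedAddCommGroup G] {H : Type*} [NormedAddCommGroup H]

/-- The random vector `Z` is (almost everywhere strongly) measurable and has finite absolute moments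
of every order. This one property supplies all integrability and measurability side conditions. -/
def HasFiniteMoments (Z : Ω → G) (P : Measure Ω) : Prop :=
  ∀ p : ℝ≥0∞, p ≠ ∞ → MemLp Z p P

lemma hasFiniteMoments_const [IsFiniteMeasure P] (c : G) :
    HasFiniteMoments (fun _ : Ω => c) P :=
  fun _ _ => memLp_const c

namespace HasFiniteMoments

variable {Y Z : Ω → G}

lemma aestronglyMeasurable (hZ : HasFiniteMoments Z P) : AEStronglyMeasurable Z P :=
  (hZ 1 ENNReal.one_ne_top).1

lemma integrable (hZ : HasFiniteMoments Z P) : Integrable Z P :=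
  memLp_one_iff_integrable.mp (hZ 1 ENNReal.one_ne_top)

lemma add (hY : HasFiniteMoments Y P) (hZ : HasFiniteMoments Z P) :
    HasFiniteMoments (fun ω => Y ω + Z ω) P :=
  fun p hp => (hY p hp).add (hZ p hp)

lemma sub (hY : HasFiniteMoments Y P) (hZ : HasFiniteMoments Z P) :
    HasFiniteMoments (fun ω => Y ω - Z ω) P :=
  fun p hp => (hY p hp).sub (hZ p hp)

lemma norm (hZ : HasFiniteMoments Z P) : HasFiniteMoments (fun ω => ‖Z ω‖) P :=
  fun p hp => (hZ p hp).norm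

lemma of_norm_le {W : Ω → H} {R : Ω → ℝ} (hR : HasFiniteMoments R P)
    (hW : AEStronglyMeasurable W P) (hWR : ∀ ω, ‖W ω‖ ≤ R ω) : HasFiniteMoments W P :=
  fun p hp => (hR p hp).mono' hW (.of_forall hWR)

lemma of_map [MeasurableSpace G] (hZ : HasFiniteMoments id (P.map Z)) (hZm : AEMeasurable Z P) :
    HasFiniteMoments Z P :=
  fun p hp => (memLp_map_measure_iff (hZ p hp).1 hZm).mp (hZ p hp)

section NormedSpace

variable [NormedSpace ℝ G] [NormedSpace ℝ H]

lemma clm_comp (T : G →L[ℝ] H) (hZ : HasFiniteMoments Z P) :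
    HasFiniteMoments (fun ω => T (Z ω)) P :=
  fun p hp => T.comp_memLp' (hZ p hp)

lemma clm_apply {S : Ω → G →L[ℝ] H} (hS : HasFiniteMoments S P) (d : G) :
    HasFiniteMoments (fun ω => S ω d) P :=
  hS.clm_comp (ContinuousLinearMap.apply ℝ H d)

lemma const_smul (c : ℝ) (hZ : HasFiniteMoments Z P) : HasFiniteMoments (fun ω => c • Z ω) P :=
  fun p hp => (hZ p hp).const_smul c

lemma smul {φ : Ω → ℝ} (hφ : HasFiniteMoments φ P) (hZ : HasFiniteMoments Z P) :
    HasFiniteMoments (fun ω => φ ω • Z ω) P := by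
  intro p hp
  have hp2 : 2 * p ≠ ∞ := ENNReal.mul_ne_top ENNReal.ofNat_ne_top hp
  have : ENNReal.HolderTriple (2 * p) (2 * p) p :=
    ⟨by rw [ENNReal.mul_inv (by simp) (by simp), ← add_mul, ENNReal.inv_two_add_inv_two, one_mul]⟩
  exact (hZ _ hp2).smul (hφ _ hp2)

end NormedSpace

lemma mul {φ ψ : Ω → ℝ} (hφ : HasFiniteMoments φ P) (hψ : HasFiniteMoments ψ P) :
    HasFiniteMoments (fun ω => φ ω * ψ ω) P :=
  hφ.smul hψ

lemma const_mul (c : ℝ) {φ : Ω → ℝ} (hφ : HasFiniteMoments φ P) :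
    HasFiniteMoments (fun ω => c * φ ω) P :=
  hφ.const_smul c

lemma inner {G : Type*} [NormedAddCommGroup G] [InnerProductSpace ℝ G] {Z : Ω → G}
    (hZ : HasFiniteMoments Z P) (e : G) : HasFiniteMoments (fun ω => inner ℝ e (Z ω)) P :=
  hZ.clm_comp (innerSL ℝ e)

lemma pow [IsFiniteMeasure P] {φ : Ω → ℝ} (hφ : HasFiniteMoments φ P) (k : ℕ) :
    HasFiniteMoments (fun ω => φ ω ^ k) P := by
  induction k with
  | zero => simpa only [pow_zero] using hasFiniteMoments_const (1 : ℝ)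
  | succ k ih => simpa only [pow_succ] using ih.mul hφ

lemma integrable_norm_rpow [IsFiniteMeasure P] (hZ : HasFiniteMoments Z P) {q : ℝ} (hq : 0 ≤ q) :
    Integrable (fun ω => ‖Z ω‖ ^ q) P := by
  simpa only [ENNReal.toReal_ofReal hq] using
    (hZ (ENNReal.ofReal q) ENNReal.ofReal_ne_top).integrable_norm_rpow'

lemma integral_norm_rpow_le [IsProbabilityMeasure P] (hZ : HasFiniteMoments Z P) {q : ℝ}
    (hq0 : 0 ≤ q) (hq2 : q ≤ 2) :
    ∫ ω, ‖Z ω‖ ^ q ∂P ≤ (∫ ω, ‖Z ω‖ ^ 2 ∂P) ^ (q / 2) := by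
  have hpow (ω : Ω) : ‖Z ω‖ ^ q = (‖Z ω‖ ^ 2) ^ (q / 2) := by
    rw [← Real.rpow_natCast, ← Real.rpow_mul (norm_nonneg _)]
    congr 1
    norm_num
    ring
  simp only [hpow]
  refine (Real.concaveOn_rpow (by positivity) (by linarith)).le_map_integral
    (Real.continuous_rpow_const (by positivity)).continuousOn isClosed_Ici
    (.of_forall fun ω => sq_nonneg ‖Z ω‖) (hZ.norm.pow 2).integrable ?_
  simpa only [Function.comp_def, ← hpow] using hZ.integrable_norm_rpow hq0

end HasFiniteMoments

end FiniteMoments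

section PolynomialGrowth

variable {F G : Type*} [NormedAddCommGroup F] [NormedAddCommGroup G]

/-- `‖g u‖` is bounded by a constant multiple of a power of `1 + ‖u‖`. -/
def HasPolynomialGrowth (g : F → G) : Prop :=
  ∃ (C : ℝ) (k : ℕ), 0 ≤ C ∧ ∀ u, ‖g u‖ ≤ C * (1 + ‖u‖) ^ k

lemma HasPolynomialGrowth.of_norm_sub_le {g g' : F → G} (hg : HasPolynomialGrowth g) {δ : ℝ}
    (hgg' : ∀ u, ‖g u - g' u‖ ≤ δ) : HasPolynomialGrowth g' := by
  obtain ⟨C, k, hC, hg⟩ := hg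
  have hδ : 0 ≤ δ := (norm_nonneg _).trans (hgg' 0)
  refine ⟨C + δ, k, by positivity, fun u => ?_⟩
  have h1 : (1 : ℝ) ≤ (1 + ‖u‖) ^ k := one_le_pow₀ (by linarith [norm_nonneg u])
  calc ‖g' u‖ ≤ ‖g u‖ + ‖g u - g' u‖ := by
        simpa only [sub_sub_cancel] using norm_sub_le (g u) (g u - g' u)
    _ ≤ C * (1 + ‖u‖) ^ k + δ * (1 + ‖u‖) ^ k :=
        add_le_add (hg u) ((hgg' u).trans (le_mul_of_one_le_right hδ h1))
    _ = (C + δ) * (1 + ‖u‖) ^ k := by ring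

lemma HasPolynomialGrowth.of_sub_const {g : F → G} {c : G}
    (hg : HasPolynomialGrowth fun u => g u - c) : HasPolynomialGrowth g :=
  hg.of_norm_sub_le (δ := ‖c‖) fun u => by simp

lemma HasPolynomialGrowth.hasFiniteMoments_comp [MeasurableSpace F] [BorelSpace F] {Ω : Type*}
    [MeasurableSpace Ω] {P : Measure Ω} [IsFiniteMeasure P] {g : F → G} {Z : Ω → F}
    (hg : HasPolynomialGrowth g) (hgm : StronglyMeasurable g) (hZ : HasFiniteMoments Z P) :
    HasFiniteMoments (fun ω => g (Z ω)) P := by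
  obtain ⟨C, k, -, hg⟩ := hg
  exact ((((hasFiniteMoments_const 1).add hZ.norm).pow k).const_mul C).of_norm_le
    (hgm.aestronglyMeasurable.comp_aemeasurable hZ.aestronglyMeasurable.aemeasurable)
    fun ω => hg (Z ω)

lemma HasPolynomialGrowth.of_fderiv [NormedSpace ℝ F] [NormedSpace ℝ G] {g : F → G}
    (hd : Differentiable ℝ g) (hg : HasPolynomialGrowth (fderiv ℝ g)) : HasPolynomialGrowth g := by
  obtain ⟨C, k, hC, hg⟩ := hg
  have hincr (u : F) : ‖g u - g 0‖ ≤ C * (1 + ‖u‖) ^ k * ‖u - 0‖ :=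
    (convex_closedBall (0 : F) ‖u‖).norm_image_sub_le_of_norm_fderiv_le
      (fun v _ => hd v)
      (fun v hv => (hg v).trans (by gcongr; exact mem_closedBall_zero_iff.mp hv))
      (by simp) (by simp)
  refine .of_sub_const (c := g 0) ⟨C, k + 1, hC, fun u => (hincr u).trans ?_⟩
  rw [sub_zero, pow_succ, ← mul_assoc]
  gcongr
  linarith

lemma HasPolynomialGrowth.of_holderWith {g : F → G} {C r : ℝ≥0} (hg : HolderWith C r g) :
    HasPolynomialGrowth g := by
  refine .of_sub_const (c := g 0) ⟨C, ⌈(r : ℝ)⌉₊, C.2, fun u => ?_⟩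
  have hu : (1 : ℝ) ≤ 1 + ‖u‖ := by linarith [norm_nonneg u]
  calc ‖g u - g 0‖ ≤ C * ‖u‖ ^ (r : ℝ) := by
        simpa only [dist_eq_norm, sub_zero] using hg.dist_le u 0
    _ ≤ C * (1 + ‖u‖) ^ (r : ℝ) := by gcongr; linarith
    _ ≤ C * (1 + ‖u‖) ^ ⌈(r : ℝ)⌉₊ := by
        rw [← Real.rpow_natCast]
        gcongr
        exact Nat.le_ceil _

end PolynomialGrowth

section Holder

lemma holderWith_of_norm_sub_le {F G : Type*} [NormedAddCommGroup F] [NormedAddCommGroup G]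
    {g : F → G} {C r : ℝ≥0} (hg : ∀ x y, ‖g x - g y‖ ≤ C * ‖x - y‖ ^ (r : ℝ)) :
    HolderWith C r g := by
  intro x y
  rw [edist_nndist, edist_nndist, ← ENNReal.coe_rpow_of_nonneg _ r.coe_nonneg, ← ENNReal.coe_mul,
    ENNReal.coe_le_coe, ← NNReal.coe_le_coe]
  simpa [← dist_eq_norm] using hg x y

variable {F G : Type*} [NormedAddCommGroup F] [NormedSpace ℝ F] [NormedAddCommGroup G]
  [NormedSpace ℝ G]

lemma norm_sub_sub_fderiv_le_of_holderWith {f : F → G} {L ν : ℝ≥0} (hf : Differentiable ℝ f)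
    (hf' : HolderWith L ν (fderiv ℝ f)) (x y : F) :
    ‖f y - f x - fderiv ℝ f x (y - x)‖ ≤ L / (1 + ν) * ‖y - x‖ ^ (1 + ν : ℝ) := by
  set d := y - x with hd
  have hν : 0 < (1 + ν : ℝ) := by positivity
  have hline (t : ℝ) : HasDerivAt (fun t : ℝ => x + t • d) d t := by
    simpa only [one_smul] using ((hasDerivAt_id' t).smul_const d).const_add x
  have hremainder (t : ℝ) : HasDerivAt (fun t : ℝ => f (x + t • d) - f x - t • fderiv ℝ f x d)
      (fderiv ℝ f (x + t • d) d - fderiv ℝ f x d) t := by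
    have hcomp := (hf (x + t • d)).hasFDerivAt.comp_hasDerivAt t (hline t)
    refine ((hcomp.sub_const (f x)).sub
      ((hasDerivAt_id' t).smul_const (fderiv ℝ f x d))).congr_deriv ?_
    rw [one_smul]
  have hbound (t : ℝ) : HasDerivAt (fun t : ℝ => L / (1 + ν) * ‖d‖ ^ (1 + ν : ℝ) * t ^ (1 + ν : ℝ))
      (L * ‖d‖ ^ (1 + ν : ℝ) * t ^ (ν : ℝ)) t := by
    refine ((Real.hasDerivAt_rpow_const (x := t) (.inr (by simp : 1 ≤ (1 + ν : ℝ)))).const_mul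
      (L / (1 + ν) * ‖d‖ ^ (1 + ν : ℝ))).congr_deriv ?_
    rw [add_sub_cancel_left]
    field_simp
  have hderiv_le (t : ℝ) (ht : t ∈ Set.Ico (0 : ℝ) 1) :
      ‖fderiv ℝ f (x + t • d) d - fderiv ℝ f x d‖ ≤ L * ‖d‖ ^ (1 + ν : ℝ) * t ^ (ν : ℝ) := by
    calc ‖(fderiv ℝ f (x + t • d) - fderiv ℝ f x) d‖
        ≤ ‖fderiv ℝ f (x + t • d) - fderiv ℝ f x‖ * ‖d‖ := ContinuousLinearMap.le_opNorm _ _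
      _ ≤ L * ‖t • d‖ ^ (ν : ℝ) * ‖d‖ := by
          gcongr
          simpa only [dist_eq_norm, add_sub_cancel_left] using hf'.dist_le (x + t • d) x
      _ = L * ‖d‖ ^ (1 + ν : ℝ) * t ^ (ν : ℝ) := by
          rw [norm_smul, Real.norm_of_nonneg ht.1, Real.mul_rpow ht.1 (norm_nonneg d),
            Real.rpow_one_add' (norm_nonneg d) hν.ne']
          ring
  simpa [hd] using image_norm_le_of_norm_deriv_right_le_deriv_boundary
    (fun t _ => (hremainder t).continuousAt.continuousWithinAt)
    (fun t _ => (hremainder t).hasDerivWithinAt) (by simp [Real.zero_rpow hν.ne'])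
    hbound hderiv_le (Set.right_mem_Icc.mpr zero_le_one)

end Holder

section WithDensity

variable {α : Type*} [MeasurableSpace α] {ρ : Measure α} {w : α → ℝ}
  {G : Type*} [NormedAddCommGroup G] [NormedSpace ℝ G]

lemma integral_withDensity_ofReal (hw : Measurable w) (hw0 : ∀ u, 0 ≤ w u) (g : α → G) :
    ∫ u, g u ∂ρ.withDensity (fun u => ENNReal.ofReal (w u)) = ∫ u, w u • g u ∂ρ := by
  rw [integral_withDensity_eq_integral_toReal_smul hw.ennreal_ofReal (by simp)]
  simp only [ENNReal.toReal_ofReal (hw0 _)]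

lemma integrable_withDensity_ofReal_iff (hw : Measurable w) (hw0 : ∀ u, 0 ≤ w u) {g : α → G} :
    Integrable g (ρ.withDensity fun u => ENNReal.ofReal (w u)) ↔
      Integrable (fun u => w u • g u) ρ := by
  rw [integrable_withDensity_iff_integrable_smul' hw.ennreal_ofReal (by simp)]
  simp only [ENNReal.toReal_ofReal (hw0 _)]

end WithDensity

section GaussDensity

variable {F : Type*} [NormedAddCommGroup F] [MeasurableSpace F]

/-- The density `u ↦ κ⁻¹ exp (-‖u‖² / 2)`, with `κ = ∫ exp (-‖v‖² / 2) ∂lam`, of the standard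
Gaussian measure with respect to a Haar measure `lam` of arbitrary normalization. -/
noncomputable def gaussDensity (lam : Measure F) (u : F) : ℝ :=
  1 / (∫ v : F, Real.exp (-(1 / 2) * ‖v‖ ^ 2) ∂lam) * Real.exp (-(1 / 2) * ‖u‖ ^ 2)

lemma gaussDensity_nonneg (lam : Measure F) (u : F) : 0 ≤ gaussDensity lam u := by
  have : 0 ≤ ∫ v : F, Real.exp (-(1 / 2) * ‖v‖ ^ 2) ∂lam := integral_nonneg fun v => by positivity
  unfold gaussDensity
  positivity

lemma measurable_gaussDensity [BorelSpace F] (lam : Measure F) :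
    Measurable (gaussDensity lam) := by
  unfold gaussDensity
  fun_prop

variable [InnerProductSpace ℝ F]

lemma hasFDerivAt_gaussDensity (lam : Measure F) (u : F) :
    HasFDerivAt (gaussDensity lam) (-gaussDensity lam u • innerSL ℝ u) u := by
  refine (((hasStrictFDerivAt_norm_sq u).hasFDerivAt.const_mul (-(1 / 2) : ℝ)).exp.const_mul
    (1 / ∫ v : F, Real.exp (-(1 / 2) * ‖v‖ ^ 2) ∂lam)).congr_fderiv ?_
  ext d
  simp [gaussDensity, mul_assoc]

variable [BorelSpace F] [FiniteDimensional ℝ F] (lam : Measure F) [lam.IsAddHaarMeasure]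

lemma integrable_exp_neg_half_sq_norm :
    Integrable (fun u : F => Real.exp (-(1 / 2) * ‖u‖ ^ 2)) lam := by
  have hvol : Integrable (fun u : F => Real.exp (-(1 / 2) * ‖u‖ ^ 2)) := by
    refine (GaussianFourier.integrable_cexp_neg_mul_sq_norm_add (V := F) (b := 1 / 2)
      (by norm_num) 0 0).norm.congr (.of_forall fun u => ?_)
    simp [Complex.norm_exp, ← Complex.ofReal_pow]
  rw [Measure.isAddLeftInvariant_eq_smul lam volume]
  exact hvol.smul_measure_nnreal

lemma integral_cexp_neg_half_sq_norm_add_inner (t : F) :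
    ∫ v : F, Complex.exp (-(1 / 2) * ‖v‖ ^ 2 + Complex.I * inner ℝ t v) ∂lam =
      (∫ v : F, Real.exp (-(1 / 2) * ‖v‖ ^ 2) ∂lam : ℝ) * Complex.exp (-‖t‖ ^ 2 / 2) := by
  rw [Measure.isAddLeftInvariant_eq_smul lam volume, integral_smul_nnreal_measure,
    integral_smul_nnreal_measure,
    GaussianFourier.integral_cexp_neg_mul_sq_norm_add (b := 1 / 2) (by norm_num),
    GaussianFourier.integral_rexp_neg_mul_sq_norm (b := 1 / 2) (by norm_num),
    NNReal.smul_def, NNReal.smul_def, smul_eq_mul, Complex.real_smul, Complex.ofReal_mul,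
    Complex.ofReal_cpow (by positivity), Complex.I_sq, mul_assoc]
  push_cast
  ring_nf

theorem stdGaussian_eq_withDensity :
    stdGaussian F = lam.withDensity fun u => ENNReal.ofReal (gaussDensity lam u) := by
  have : IsFiniteMeasure (lam.withDensity fun u => ENNReal.ofReal (gaussDensity lam u)) :=
    isFiniteMeasure_withDensity_ofReal ((integrable_exp_neg_half_sq_norm lam).const_mul _).2
  have hκ : ((∫ v : F, Real.exp (-(1 / 2) * ‖v‖ ^ 2) ∂lam : ℝ) : ℂ) ≠ 0 :=
    Complex.ofReal_ne_zero.mpr (integral_exp_pos (integrable_exp_neg_half_sq_norm lam)).ne'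
  refine Measure.ext_of_charFun (funext fun t => ?_)
  rw [charFun_stdGaussian, charFun_apply,
    integral_withDensity_ofReal (measurable_gaussDensity lam) (gaussDensity_nonneg lam),
    ← mul_right_inj' hκ, ← integral_cexp_neg_half_sq_norm_add_inner, ← integral_const_mul]
  refine integral_congr_ae (.of_forall fun u => ?_)
  simp only [gaussDensity, Complex.real_smul, Complex.ofReal_mul, Complex.ofReal_div,
    Complex.ofReal_one, Complex.ofReal_exp, ← mul_assoc, mul_one_div_cancel hκ, one_mul,
    ← Complex.exp_add, real_inner_comm, mul_comm Complex.I]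
  push_cast
  rfl

end GaussDensity

section Moments

variable {F : Type*} [NormedAddCommGroup F] [InnerProductSpace ℝ F] [FiniteDimensional ℝ F]
  [MeasurableSpace F] [BorelSpace F]

lemma hasFiniteMoments_id_stdGaussian : HasFiniteMoments (fun u : F => u) (stdGaussian F) :=
  fun p hp => IsGaussian.memLp_id _ p hp

lemma HasFiniteMoments.of_map_eq_stdGaussian {Ω : Type*} [MeasurableSpace Ω] {P : Measure Ω}
    {U : Ω → F} (hU : AEMeasurable U P) (hlaw : P.map U = stdGaussian F) :
    HasFiniteMoments U P :=
  .of_map (hlaw ▸ hasFiniteMoments_id_stdGaussian) hU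

theorem integral_fderiv_apply_stdGaussian {g : F → ℝ} {g' : F → StrongDual ℝ F}
    (hd : ∀ u, HasFDerivAt g (g' u) u) (hg : HasFiniteMoments g (stdGaussian F))
    (hg' : HasFiniteMoments g' (stdGaussian F)) (d : F) :
    ∫ u, g' u d ∂stdGaussian F = ∫ u, g u * inner ℝ d u ∂stdGaussian F := by
  have hw := measurable_gaussDensity (volume : Measure F)
  have hw0 := gaussDensity_nonneg (volume : Measure F)
  have hw' (u : F) := hasFDerivAt_gaussDensity volume u
  have hg'_apply (u : F) : fderiv ℝ g u d = g' u d := by rw [(hd u).fderiv]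
  have hw'_apply (u : F) : fderiv ℝ (gaussDensity volume) u d =
      -(gaussDensity volume u * inner ℝ d u) := by simp [(hw' u).fderiv, real_inner_comm]
  have hgd := (hg.mul (hasFiniteMoments_id_stdGaussian.inner d)).integrable
  have hg := hg.integrable
  have hg'd := (hg'.clm_apply d).integrable
  rw [stdGaussian_eq_withDensity volume] at hg hgd hg'd ⊢
  rw [integrable_withDensity_ofReal_iff hw hw0] at hg hgd hg'd
  simp only [integral_withDensity_ofReal hw hw0, smul_eq_mul, ← hg'_apply]
  rw [integral_mul_fderiv_eq_neg_fderiv_mul_of_integrable _ _ hg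
    (fun u _ => (hw' u).differentiableAt) (fun u _ => (hd u).differentiableAt), ← integral_neg]
  · refine integral_congr_ae (.of_forall fun u => ?_)
    simp only [hw'_apply]
    ring
  · refine hgd.neg.congr (.of_forall fun u => ?_)
    simp only [hw'_apply, Pi.neg_apply, smul_eq_mul]
    ring
  · simpa only [hg'_apply, smul_eq_mul] using hg'd

lemma integral_mul_norm_sq_stdGaussian {φ : F → ℝ} {φ' : F → StrongDual ℝ F}
    (hd : ∀ u, HasFDerivAt φ (φ' u) u) (hφ : HasFiniteMoments φ (stdGaussian F))
    (hφ' : HasFiniteMoments φ' (stdGaussian F)) :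
    ∫ u, φ u * ‖u‖ ^ 2 ∂stdGaussian F =
      Module.finrank ℝ F * ∫ u, φ u ∂stdGaussian F + ∫ u, φ' u u ∂stdGaussian F := by
  let b := stdOrthonormalBasis ℝ F
  have hcoord (i) : HasFiniteMoments (fun u => inner ℝ (b i) u) (stdGaussian F) :=
    hasFiniteMoments_id_stdGaussian.inner _
  have hterm (i) : Integrable (fun u => φ' u (b i) * inner ℝ (b i) u) (stdGaussian F) :=
    ((hφ'.clm_apply (b i)).mul (hcoord i)).integrable
  have hparts (i) : ∫ u, φ u * inner ℝ (b i) u ^ 2 ∂stdGaussian F =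
      ∫ u, φ u ∂stdGaussian F + ∫ u, φ' u (b i) * inner ℝ (b i) u ∂stdGaussian F := by
    have hstein := integral_fderiv_apply_stdGaussian
      (fun u => (hd u).mul (innerSL ℝ (b i)).hasFDerivAt) (hφ.mul (hcoord i))
      ((hφ.smul (hasFiniteMoments_const _)).add ((hcoord i).smul hφ')) (b i)
    simp only [Pi.mul_apply, innerSL_apply_apply] at hstein
    rw [← integral_add hφ.integrable (hterm i)]
    simp only [sq, ← mul_assoc]
    rw [← hstein]
    simp [mul_comm]
  have happly (u : F) : φ' u u = ∑ i, φ' u (b i) * inner ℝ (b i) u := by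
    nth_rw 2 [← b.sum_repr' u]
    simp [mul_comm]
  simp only [happly, ← b.sum_sq_inner_right, Finset.mul_sum]
  rw [integral_finsetSum _ fun i _ => (hφ.mul ((hcoord i).pow 2)).integrable,
    integral_finsetSum _ fun i _ => hterm i]
  simp [hparts, Finset.sum_add_distrib]

lemma integral_mul_norm_sq_stdGaussian_of_homogeneous {φ : F → ℝ} {φ' : F → StrongDual ℝ F}
    {m : ℝ} (hd : ∀ u, HasFDerivAt φ (φ' u) u) (hφ : HasFiniteMoments φ (stdGaussian F))
    (hφ' : HasFiniteMoments φ' (stdGaussian F)) (hm : ∀ u, φ' u u = m * φ u) :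
    ∫ u, φ u * ‖u‖ ^ 2 ∂stdGaussian F =
      (Module.finrank ℝ F + m) * ∫ u, φ u ∂stdGaussian F := by
  rw [integral_mul_norm_sq_stdGaussian hd hφ hφ']
  simp only [hm, integral_const_mul, add_mul]

lemma integral_norm_pow_succ_stdGaussian (k : ℕ) :
    ∫ u : F, (‖u‖ ^ 2) ^ (k + 1) ∂stdGaussian F =
      (Module.finrank ℝ F + 2 * k) * ∫ u : F, (‖u‖ ^ 2) ^ k ∂stdGaussian F := by
  have hid := hasFiniteMoments_id_stdGaussian (F := F)
  simp only [pow_succ (_ ^ 2) k]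
  refine integral_mul_norm_sq_stdGaussian_of_homogeneous
    (fun u => ((hasStrictFDerivAt_norm_sq u).hasFDerivAt.pow k)) ((hid.norm.pow 2).pow k) ?_ ?_
  · simpa only [nsmul_eq_mul, Nat.cast_smul_eq_nsmul] using
      (((hid.norm.pow 2).pow (k - 1)).const_mul k).smul
        ((hid.clm_comp (innerSL ℝ)).const_smul (2 : ℕ))
  · intro u
    cases k with
    | zero => simp
    | succ k => simp; ring

lemma integral_norm_sq_stdGaussian : ∫ u : F, ‖u‖ ^ 2 ∂stdGaussian F = Module.finrank ℝ F := by
  simpa using integral_norm_pow_succ_stdGaussian (F := F) 0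

lemma integral_norm_pow_six_stdGaussian_le :
    ∫ u : F, ‖u‖ ^ 6 ∂stdGaussian F ≤ (Module.finrank ℝ F + 6 : ℝ) ^ 3 := by
  set n := (Module.finrank ℝ F : ℝ)
  calc ∫ u : F, ‖u‖ ^ 6 ∂stdGaussian F = ∫ u : F, (‖u‖ ^ 2) ^ (2 + 1) ∂stdGaussian F := by
        simp only [← pow_mul]
    _ = (n + 4) * ((n + 2) * n) := by
        rw [integral_norm_pow_succ_stdGaussian, integral_norm_pow_succ_stdGaussian 1]
        simp only [pow_one, integral_norm_sq_stdGaussian]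
        push_cast
        ring
    _ ≤ (n + 6) ^ 3 := by
        have : 0 ≤ n := Nat.cast_nonneg _
        nlinarith

lemma integral_apply_sq_stdGaussian (s : StrongDual ℝ F) :
    ∫ u, s u ^ 2 ∂stdGaussian F = ‖s‖ ^ 2 := by
  rw [← variance_dual_stdGaussian, variance_of_integral_eq_zero s.continuous.aemeasurable
    (integral_strongDual_stdGaussian s)]

lemma integral_apply_sq_mul_norm_sq_stdGaussian (s : StrongDual ℝ F) :
    ∫ u, s u ^ 2 * ‖u‖ ^ 2 ∂stdGaussian F = (Module.finrank ℝ F + 2) * ‖s‖ ^ 2 := by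
  have hs : HasFiniteMoments (fun u => s u) (stdGaussian F) :=
    hasFiniteMoments_id_stdGaussian.clm_comp s
  rw [← integral_apply_sq_stdGaussian]
  refine integral_mul_norm_sq_stdGaussian_of_homogeneous (fun u => s.hasFDerivAt.pow 2)
    (hs.pow 2) ?_ ?_
  · simpa only [nsmul_eq_mul] using ((hs.pow 1).const_mul (2 : ℕ)).smul (hasFiniteMoments_const s)
  · intro u
    simp
    ring

end Moments

section Smoothing

variable {F : Type*} [NormedAddCommGroup F] [InnerProductSpace ℝ F] [FiniteDimensional ℝ F]
  [MeasurableSpace F] [BorelSpace F]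

lemma hasFDerivAt_integral_smul_comp_add {Ω : Type*} [MeasurableSpace Ω] {P : Measure Ω}
    [IsFiniteMeasure P] {f : F → ℝ} (hd : Differentiable ℝ f)
    (hf' : HasPolynomialGrowth (fderiv ℝ f)) {U : Ω → F} {w : Ω → ℝ}
    (hU : HasFiniteMoments U P) (hw : HasFiniteMoments w P) (x : F) :
    HasFDerivAt (fun z => ∫ ω, w ω * f (z + U ω) ∂P)
      (∫ ω, w ω • fderiv ℝ f (x + U ω) ∂P) x := by
  have hshift (z : F) : HasFiniteMoments (fun ω => z + U ω) P := (hasFiniteMoments_const z).add hU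
  have hf (z : F) : HasFiniteMoments (fun ω => w ω * f (z + U ω)) P :=
    hw.mul ((HasPolynomialGrowth.of_fderiv hd hf').hasFiniteMoments_comp
      hd.continuous.stronglyMeasurable (hshift z))
  have hfderiv : HasFiniteMoments (fun ω => w ω • fderiv ℝ f (x + U ω)) P :=
    hw.smul (hf'.hasFiniteMoments_comp (measurable_fderiv ℝ f).stronglyMeasurable (hshift x))
  obtain ⟨C, k, hC, hgrowth⟩ := hf'
  have hdominating : HasFiniteMoments (fun ω => ‖w ω‖ * (C * (2 + ‖x‖ + ‖U ω‖) ^ k)) P :=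
    hw.norm.mul ((((hasFiniteMoments_const _).add hU.norm).pow k).const_mul C)
  refine hasFDerivAt_integral_of_dominated_of_fderiv_le
    (F' := fun z ω => w ω • fderiv ℝ f (z + U ω)) (Metric.ball_mem_nhds x one_pos)
    (.of_forall fun z => (hf z).aestronglyMeasurable) (hf x).integrable
    hfderiv.aestronglyMeasurable (.of_forall fun ω z hz => ?_) hdominating.integrable
    (.of_forall fun ω z _ => ?_)
  · have hz : ‖z‖ ≤ ‖x‖ + 1 := by
      linarith [norm_le_norm_add_norm_sub' z x, (mem_ball_iff_norm.mp hz).le]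
    rw [norm_smul]
    gcongr
    refine (hgrowth _).trans ?_
    have : 1 + ‖z + U ω‖ ≤ 2 + ‖x‖ + ‖U ω‖ := by linarith [norm_add_le z (U ω)]
    gcongr
  · exact ((hasFDerivAt_comp_add_right (U ω)).mpr (hd _).hasFDerivAt).const_mul (w ω)

lemma HasPolynomialGrowth.hasFiniteMoments_comp_add_smul {G : Type*}
    [NormedAddCommGroup G] {g : F → G} (hg : HasPolynomialGrowth g)
    (hgm : StronglyMeasurable g) (μ : ℝ) (x : F) :
    HasFiniteMoments (fun u => g (x + μ • u)) (stdGaussian F) :=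
  hg.hasFiniteMoments_comp hgm
    ((hasFiniteMoments_const x).add (hasFiniteMoments_id_stdGaussian.const_smul μ))

section VectorValued

variable {G : Type*} [NormedAddCommGroup G] [NormedSpace ℝ G]

/-- The Gaussian smoothing `x ↦ E g(x + μ u)` of `g`, where `u` is a standard Gaussian vector of
the Euclidean space `F`. It is vector valued so that it also applies to gradients. -/
noncomputable def gaussSmooth (g : F → G) (μ : ℝ) (x : F) : G :=
  ∫ u, g (x + μ • u) ∂stdGaussian F

variable {g : F → G} {L ν : ℝ≥0}

lemma holderWith_gaussSmooth (hg : HolderWith L ν g) (hgm : StronglyMeasurable g) (μ : ℝ) :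
    HolderWith L ν (gaussSmooth g μ) := by
  have hint (x : F) := ((HasPolynomialGrowth.of_holderWith hg).hasFiniteMoments_comp_add_smul
    hgm μ x).integrable
  refine holderWith_of_norm_sub_le fun x y => ?_
  rw [gaussSmooth, gaussSmooth, ← integral_sub (hint x) (hint y)]
  refine (norm_integral_le_of_norm_le_const (C := L * ‖x - y‖ ^ (ν : ℝ))
    (.of_forall fun u => ?_)).trans (by simp)
  simpa only [dist_eq_norm, add_sub_add_right_eq_sub] using hg.dist_le (x + μ • u) (y + μ • u)

lemma norm_integral_inner_smul_comp_le [CompleteSpace G] (hg : HolderWith L ν g)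
    (hgm : StronglyMeasurable g) (hν : ν ≤ 1) {μ : ℝ} (hμ : 0 ≤ μ) (x e : F) :
    ‖∫ u, inner ℝ e u • g (x + μ • u) ∂stdGaussian F‖ ≤
      L * μ ^ (ν : ℝ) * ‖e‖ * (Module.finrank ℝ F : ℝ) ^ ((1 + ν : ℝ) / 2) := by
  have hid := hasFiniteMoments_id_stdGaussian (F := F)
  have hgx := (HasPolynomialGrowth.of_holderWith hg).hasFiniteMoments_comp_add_smul hgm μ x
  -- `⟪e, u⟫` has mean zero, so `g` may be recentred at `g x`, where the Hölder bound is useful.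
  have hcentered : ∫ u, inner ℝ e u • g (x + μ • u) ∂stdGaussian F =
      ∫ u, inner ℝ e u • (g (x + μ • u) - g x) ∂stdGaussian F := by
    have hmean : ∫ u, inner ℝ e u ∂stdGaussian F = 0 :=
      integral_strongDual_stdGaussian (innerSL ℝ e)
    simp only [smul_sub]
    rw [integral_sub ((hid.inner e).smul hgx).integrable
      ((hid.inner e).smul (hasFiniteMoments_const (g x))).integrable, integral_smul_const, hmean,
      zero_smul, sub_zero]
  have hpointwise (u : F) : ‖inner ℝ e u • (g (x + μ • u) - g x)‖ ≤
      L * μ ^ (ν : ℝ) * ‖e‖ * ‖u‖ ^ (1 + ν : ℝ) := by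
    calc ‖inner ℝ e u • (g (x + μ • u) - g x)‖ ≤ ‖e‖ * ‖u‖ * (L * ‖μ • u‖ ^ (ν : ℝ)) := by
          rw [norm_smul]
          gcongr
          · exact norm_inner_le_norm e u
          · simpa only [dist_eq_norm, add_sub_cancel_left] using hg.dist_le (x + μ • u) x
      _ = L * μ ^ (ν : ℝ) * ‖e‖ * ‖u‖ ^ (1 + ν : ℝ) := by
          rw [norm_smul, Real.norm_of_nonneg hμ, Real.mul_rpow hμ (norm_nonneg u),
            Real.rpow_one_add' (norm_nonneg u) (by positivity)]
          ring
  calc ‖∫ u, inner ℝ e u • g (x + μ • u) ∂stdGaussian F‖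
      ≤ ∫ u, L * μ ^ (ν : ℝ) * ‖e‖ * ‖u‖ ^ (1 + ν : ℝ) ∂stdGaussian F := by
        rw [hcentered]
        exact norm_integral_le_of_norm_le
          ((hid.integrable_norm_rpow (by positivity)).const_mul _) (.of_forall hpointwise)
    _ ≤ L * μ ^ (ν : ℝ) * ‖e‖ * (Module.finrank ℝ F : ℝ) ^ ((1 + ν : ℝ) / 2) := by
        rw [integral_const_mul, ← integral_norm_sq_stdGaussian]
        gcongr
        exact hid.integral_norm_rpow_le (by positivity) (by linarith [NNReal.coe_le_one.mpr hν])

end VectorValued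

variable {f : F → ℝ} {L ν : ℝ≥0} {μ : ℝ}

lemma hasFDerivAt_gaussSmooth (hd : Differentiable ℝ f)
    (hf' : HasPolynomialGrowth (fderiv ℝ f)) (μ : ℝ) (x : F) :
    HasFDerivAt (gaussSmooth f μ) (gaussSmooth (fderiv ℝ f) μ x) x := by
  unfold gaussSmooth
  simpa only [one_mul, one_smul] using hasFDerivAt_integral_smul_comp_add hd hf'
    (hasFiniteMoments_id_stdGaussian.const_smul μ) (hasFiniteMoments_const 1) x

lemma fderiv_gaussSmooth (hd : Differentiable ℝ f) (hf' : HasPolynomialGrowth (fderiv ℝ f))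
    (μ : ℝ) : fderiv ℝ (gaussSmooth f μ) = gaussSmooth (fderiv ℝ f) μ :=
  funext fun x => (hasFDerivAt_gaussSmooth hd hf' μ x).fderiv

lemma differentiable_gaussSmooth (hd : Differentiable ℝ f)
    (hf' : HasPolynomialGrowth (fderiv ℝ f)) (μ : ℝ) : Differentiable ℝ (gaussSmooth f μ) :=
  fun x => (hasFDerivAt_gaussSmooth hd hf' μ x).differentiableAt

lemma mul_fderiv_gaussSmooth_apply (hd : Differentiable ℝ f)
    (hf' : HasPolynomialGrowth (fderiv ℝ f)) (μ : ℝ) (x e : F) :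
    μ * fderiv ℝ (gaussSmooth f μ) x e = ∫ u, inner ℝ e u * f (x + μ • u) ∂stdGaussian F := by
  have hf := (HasPolynomialGrowth.of_fderiv hd hf').hasFiniteMoments_comp_add_smul
    hd.continuous.stronglyMeasurable μ x
  have hf'x := hf'.hasFiniteMoments_comp_add_smul (measurable_fderiv ℝ f).stronglyMeasurable μ x
  have hcomp (u : F) : HasFDerivAt (fun u => f (x + μ • u)) (μ • fderiv ℝ f (x + μ • u)) u := by
    refine ((hd (x + μ • u)).hasFDerivAt.comp u
      (((hasFDerivAt_id u).const_smul μ).const_add x)).congr_fderiv ?_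
    ext d
    simp
  have hstein := integral_fderiv_apply_stdGaussian hcomp hf (hf'x.const_smul μ) e
  simp only [smul_apply, smul_eq_mul, integral_const_mul] at hstein
  rw [fderiv_gaussSmooth hd hf', gaussSmooth,
    ContinuousLinearMap.integral_apply hf'x.integrable, hstein]
  simp only [mul_comm]

lemma lipschitzWith_fderiv_gaussSmooth (hd : Differentiable ℝ f)
    (hf' : HolderWith L ν (fderiv ℝ f)) (hν : ν ≤ 1) (hμ : 0 < μ) :
    LipschitzWith (Real.toNNReal (L / μ ^ (1 - ν : ℝ) *
      (Module.finrank ℝ F : ℝ) ^ ((1 + ν : ℝ) / 2))) (fderiv ℝ (gaussSmooth f μ)) := by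
  set K : ℝ := L / μ ^ (1 - ν : ℝ) * (Module.finrank ℝ F : ℝ) ^ ((1 + ν : ℝ) / 2) with hK
  have hgrowth := HasPolynomialGrowth.of_holderWith hf'
  have hid := hasFiniteMoments_id_stdGaussian (F := F)
  have happly (e : F) : (fun x => fderiv ℝ (gaussSmooth f μ) x e) =
      fun x => μ⁻¹ * ∫ u, inner ℝ e u * f (x + μ • u) ∂stdGaussian F := by
    funext x
    rw [← mul_fderiv_gaussSmooth_apply hd hgrowth, inv_mul_cancel_left₀ hμ.ne']
  have hderiv (e x : F) : HasFDerivAt (fun x => fderiv ℝ (gaussSmooth f μ) x e)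
      (μ⁻¹ • ∫ u, inner ℝ e u • fderiv ℝ f (x + μ • u) ∂stdGaussian F) x := by
    rw [happly]
    exact (hasFDerivAt_integral_smul_comp_add hd hgrowth (hid.const_smul μ)
      (hid.inner e) x).const_mul μ⁻¹
  have hderiv_le (e x : F) :
      ‖μ⁻¹ • ∫ u, inner ℝ e u • fderiv ℝ f (x + μ • u) ∂stdGaussian F‖ ≤ K * ‖e‖ := by
    rw [norm_smul, norm_inv, Real.norm_of_nonneg hμ.le, inv_mul_le_iff₀ hμ]
    refine (norm_integral_inner_smul_comp_le hf' (measurable_fderiv ℝ f).stronglyMeasurable hν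
      hμ.le x e).trans_eq ?_
    rw [hK, Real.rpow_sub hμ, Real.rpow_one]
    field_simp
  refine LipschitzWith.of_dist_le' fun x y => ?_
  rw [dist_eq_norm, dist_eq_norm]
  refine ContinuousLinearMap.opNorm_le_bound _ (by positivity) fun e => ?_
  calc ‖fderiv ℝ (gaussSmooth f μ) x e - fderiv ℝ (gaussSmooth f μ) y e‖
      ≤ K * ‖e‖ * ‖x - y‖ :=
        convex_univ.norm_image_sub_le_of_norm_hasFDerivWithin_le
          (fun z _ => (hderiv e z).hasFDerivWithinAt) (fun z _ => hderiv_le e z)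
          (Set.mem_univ y) (Set.mem_univ x)
    _ = K * ‖x - y‖ * ‖e‖ := by ring

lemma abs_gaussSmooth_sub_le (hd : Differentiable ℝ f) (hf' : HolderWith L ν (fderiv ℝ f))
    (hν : ν ≤ 1) (hμ : 0 ≤ μ) (x : F) :
    |gaussSmooth f μ x - f x| ≤
      L * μ ^ (1 + ν : ℝ) / (1 + ν) * (Module.finrank ℝ F : ℝ) ^ ((1 + ν : ℝ) / 2) := by
  have hid := hasFiniteMoments_id_stdGaussian (F := F)
  have hfx := (HasPolynomialGrowth.of_fderiv hd (.of_holderWith hf')).hasFiniteMoments_comp_add_smul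
    hd.continuous.stronglyMeasurable μ x
  have hlinear := (hid.const_smul μ).clm_comp (fderiv ℝ f x)
  have hmean : ∫ u, fderiv ℝ f x (μ • u) ∂stdGaussian F = 0 := by
    simp only [map_smul, smul_eq_mul, integral_const_mul, integral_strongDual_stdGaussian, mul_zero]
  have hremainder : gaussSmooth f μ x - f x =
      ∫ u, (f (x + μ • u) - f x - fderiv ℝ f x (μ • u)) ∂stdGaussian F := by
    rw [integral_sub (hfx.sub (hasFiniteMoments_const _)).integrable hlinear.integrable,
      integral_sub hfx.integrable (integrable_const _), hmean]
    simp [gaussSmooth]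
  have hpointwise (u : F) : ‖f (x + μ • u) - f x - fderiv ℝ f x (μ • u)‖ ≤
      L * μ ^ (1 + ν : ℝ) / (1 + ν) * ‖u‖ ^ (1 + ν : ℝ) := by
    have htaylor := norm_sub_sub_fderiv_le_of_holderWith hd hf' x (x + μ • u)
    rw [add_sub_cancel_left, norm_smul, Real.norm_of_nonneg hμ,
      Real.mul_rpow hμ (norm_nonneg u)] at htaylor
    exact htaylor.trans_eq (by ring)
  rw [hremainder, ← Real.norm_eq_abs]
  calc ‖∫ u, (f (x + μ • u) - f x - fderiv ℝ f x (μ • u)) ∂stdGaussian F‖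
      ≤ ∫ u, L * μ ^ (1 + ν : ℝ) / (1 + ν) * ‖u‖ ^ (1 + ν : ℝ) ∂stdGaussian F :=
        norm_integral_le_of_norm_le ((hid.integrable_norm_rpow (by positivity)).const_mul _)
          (.of_forall hpointwise)
    _ ≤ L * μ ^ (1 + ν : ℝ) / (1 + ν) * (Module.finrank ℝ F : ℝ) ^ ((1 + ν : ℝ) / 2) := by
        rw [integral_const_mul, ← integral_norm_sq_stdGaussian]
        gcongr
        exact hid.integral_norm_rpow_le (by positivity) (by linarith [NNReal.coe_le_one.mpr hν])

lemma le_gaussSmooth (hf : HasPolynomialGrowth f) (hfm : StronglyMeasurable f) {c : ℝ}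
    (hc : ∀ x, c ≤ f x) (μ : ℝ) (x : F) : c ≤ gaussSmooth f μ x := by
  simpa [gaussSmooth] using integral_mono (integrable_const c)
    (hf.hasFiniteMoments_comp_add_smul hfm μ x).integrable fun u => hc (x + μ • u)

end Smoothing

section SlackTaylorBound

/-- The quadratic upper and lower Taylor bound with slack: `g` deviates from its linearization at
any point by at most `A₁ / 2 * ‖y - x‖ ^ 2 + A₂`. -/
def HasSlackTaylorBound {F : Type*} [NormedAddCommGroup F] [NormedSpace ℝ F] (g : F → ℝ)
    (A₁ A₂ : ℝ) : Prop :=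
  ∀ x y, |g y - g x - fderiv ℝ g x (y - x)| ≤ A₁ / 2 * ‖y - x‖ ^ 2 + A₂

lemma rpow_one_add_le_mul_sq_add {ν t δ : ℝ} (hν0 : 0 ≤ ν) (hν1 : ν ≤ 1) (ht : 0 ≤ t)
    (hδ : 0 < δ) : t ^ (1 + ν) ≤ (1 / δ) ^ ((1 - ν) / (1 + ν)) * t ^ 2 + δ := by
  set a := (1 / δ) ^ ((1 - ν) / (1 + ν)) * t ^ 2 with ha
  have ha0 : 0 ≤ a := by positivity
  have hgeom_mean : a ^ ((1 + ν) / 2) * δ ^ ((1 - ν) / 2) = t ^ (1 + ν) := by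
    rw [ha, Real.mul_rpow (by positivity) (by positivity), ← Real.rpow_natCast t 2,
      ← Real.rpow_mul ht, ← Real.rpow_mul (by positivity), one_div, Real.inv_rpow hδ.le,
      show (1 - ν) / (1 + ν) * ((1 + ν) / 2) = (1 - ν) / 2 by field_simp,
      show ((2 : ℕ) : ℝ) * ((1 + ν) / 2) = 1 + ν by push_cast; ring, mul_right_comm,
      inv_mul_cancel₀ (by positivity), one_mul]
  have hyoung := Real.geom_mean_le_arith_mean2_weighted (w₁ := (1 + ν) / 2) (w₂ := (1 - ν) / 2)
    (by positivity) (by linarith) ha0 hδ.le (by ring)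
  rw [hgeom_mean] at hyoung
  nlinarith

variable {F : Type*} [NormedAddCommGroup F]

lemma hasSlackTaylorBound_of_lipschitzWith [NormedSpace ℝ F] {g : F → ℝ} {K : ℝ≥0}
    (hd : Differentiable ℝ g) (hg' : LipschitzWith K (fderiv ℝ g)) :
    HasSlackTaylorBound g K 0 := by
  intro x y
  have htaylor := norm_sub_sub_fderiv_le_of_holderWith hd (holderWith_one.mpr hg') x y
  norm_num at htaylor ⊢
  exact htaylor

lemma hasSlackTaylorBound_of_holderWith [NormedSpace ℝ F] {g : F → ℝ} {L ν : ℝ≥0}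
    (hd : Differentiable ℝ g) (hg' : HolderWith L ν (fderiv ℝ g)) (hν : ν ≤ 1) {μ δ : ℝ}
    (hμ : 0 < μ) (hδ : 0 < δ) :
    HasSlackTaylorBound g ((1 / δ) ^ ((1 - ν : ℝ) / (1 + ν)) * (2 * L / μ ^ (1 - ν : ℝ)))
      (δ * L * μ ^ (1 + ν : ℝ)) := by
  intro x y
  set t := ‖y - x‖ / μ with ht
  have hyx : ‖y - x‖ = μ * t := by rw [ht, mul_div_cancel₀ _ hμ.ne']
  have ht0 : 0 ≤ t := by positivity
  have hμpow : μ ^ 2 / μ ^ (1 - ν : ℝ) = μ ^ (1 + ν : ℝ) := by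
    rw [← Real.rpow_natCast μ 2, ← Real.rpow_sub hμ]
    congr 1
    push_cast
    ring
  calc |g y - g x - fderiv ℝ g x (y - x)| ≤ L / (1 + ν) * ‖y - x‖ ^ (1 + ν : ℝ) :=
        norm_sub_sub_fderiv_le_of_holderWith hd hg' x y
    _ ≤ L * ‖y - x‖ ^ (1 + ν : ℝ) := by
        gcongr
        exact div_le_self L.2 (by simp)
    _ = L * μ ^ (1 + ν : ℝ) * t ^ (1 + ν : ℝ) := by rw [hyx, Real.mul_rpow hμ.le ht0, mul_assoc]
    _ ≤ L * μ ^ (1 + ν : ℝ) * ((1 / δ) ^ ((1 - ν : ℝ) / (1 + ν)) * t ^ 2 + δ) := by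
        gcongr
        exact rpow_one_add_le_mul_sq_add ν.2 hν ht0 hδ
    _ = (1 / δ) ^ ((1 - ν : ℝ) / (1 + ν)) * (2 * L / μ ^ (1 - ν : ℝ)) / 2 * ‖y - x‖ ^ 2 +
          δ * L * μ ^ (1 + ν : ℝ) := by
        rw [hyx, ← hμpow]
        ring

lemma IsSlackPair.hasSlackTaylorBound_gaussSmooth [InnerProductSpace ℝ F] [FiniteDimensional ℝ F]
    [MeasurableSpace F] [BorelSpace F] {f : F → ℝ} {L ν : ℝ≥0} {μ A₁ A₂ : ℝ}
    (hA : IsSlackPair (Module.finrank ℝ F) ν L μ A₁ A₂) (hd : Differentiable ℝ f)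
    (hf' : HolderWith L ν (fderiv ℝ f)) (hν : ν ≤ 1) (hμ : 0 < μ) :
    HasSlackTaylorBound (gaussSmooth f μ) A₁ A₂ := by
  have hgrowth := HasPolynomialGrowth.of_holderWith hf'
  have hdiff := differentiable_gaussSmooth hd hgrowth μ
  rcases hA with ⟨rfl, rfl⟩ | ⟨δ, hδ, rfl, rfl⟩
  · simpa only [Real.coe_toNNReal _ (by positivity : 0 ≤ L / μ ^ (1 - ν : ℝ) *
      (Module.finrank ℝ F : ℝ) ^ ((1 + ν : ℝ) / 2))] using
      hasSlackTaylorBound_of_lipschitzWith hdiff (lipschitzWith_fderiv_gaussSmooth hd hf' hν hμ)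
  · refine hasSlackTaylorBound_of_holderWith hdiff ?_ hν hμ hδ
    rw [fderiv_gaussSmooth hd hgrowth]
    exact holderWith_gaussSmooth hf' (measurable_fderiv ℝ f).stronglyMeasurable μ

end SlackTaylorBound

section Estimator

variable {F : Type*} [NormedAddCommGroup F]

/-- The scalar difference quotient of `f` at `x` with displacement `μ • u`, the coefficient of the
random gradient estimate. -/
noncomputable def diffQuot [Module ℝ F] (f : F → ℝ) (μ : ℝ) (x u : F) : ℝ :=
  (f (x + μ • u) - f x) / μ

lemma abs_diffQuot_sub_diffQuot_le [Module ℝ F] {f ftilde : F → ℝ} {δ μ : ℝ}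
    (hft : ∀ x, |f x - ftilde x| ≤ δ) (hμ : 0 < μ) (x u : F) :
    |diffQuot ftilde μ x u - diffQuot f μ x u| ≤ 2 * δ / μ := by
  rw [diffQuot, diffQuot, ← sub_div, abs_div, abs_of_pos hμ]
  gcongr
  rw [abs_le]
  constructor <;> linarith [abs_le.mp (hft (x + μ • u)), abs_le.mp (hft x)]

lemma abs_diffQuot_le_of_hasSlackTaylorBound [NormedSpace ℝ F] {f ftilde g : F → ℝ}
    {δ μ M A₁ A₂ : ℝ} (hft : ∀ x, |f x - ftilde x| ≤ δ) (hg : ∀ x, |g x - f x| ≤ M)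
    (hA : HasSlackTaylorBound g A₁ A₂) (hμ : 0 < μ) (x u : F) :
    |diffQuot ftilde μ x u| ≤
      2 * δ / μ + 2 * M / μ + |fderiv ℝ g x u| + μ * A₁ / 2 * ‖u‖ ^ 2 + A₂ / μ := by
  have htaylor := hA x (x + μ • u)
  rw [add_sub_cancel_left, norm_smul, Real.norm_of_nonneg hμ.le, map_smul, smul_eq_mul] at htaylor
  have hincr : |g (x + μ • u) - g x| ≤
      μ * |fderiv ℝ g x u| + (A₁ / 2 * (μ * ‖u‖) ^ 2 + A₂) := by
    rw [← abs_of_pos hμ, ← abs_mul, abs_of_pos hμ]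
    linarith [abs_sub_abs_le_abs_sub (g (x + μ • u) - g x) (μ * fderiv ℝ g x u)]
  rw [diffQuot, abs_div, abs_of_pos hμ, div_le_iff₀ hμ]
  calc |ftilde (x + μ • u) - ftilde x|
      ≤ 2 * δ + 2 * M + (μ * |fderiv ℝ g x u| + (A₁ / 2 * (μ * ‖u‖) ^ 2 + A₂)) := by
        rw [abs_le] at hincr ⊢
        constructor <;> linarith [abs_le.mp (hft (x + μ • u)), abs_le.mp (hft x),
          abs_le.mp (hg (x + μ • u)), abs_le.mp (hg x)]
    _ = (2 * δ / μ + 2 * M / μ + |fderiv ℝ g x u| + μ * A₁ / 2 * ‖u‖ ^ 2 + A₂ / μ) * μ := by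
        field_simp
        ring

lemma sq_add_five_le (a b c d e : ℝ) :
    (a + b + c + d + e) ^ 2 ≤ 5 * (a ^ 2 + b ^ 2 + c ^ 2 + d ^ 2 + e ^ 2) := by
  simpa [Fin.sum_univ_five] using
    sq_sum_le_card_mul_sum_sq (s := Finset.univ) (f := ![a, b, c, d, e])

lemma HasSlackTaylorBound.integral_comp_sub_smul_le [NormedSpace ℝ F] {Ω : Type*}
    [MeasurableSpace Ω] {P : Measure Ω} [IsProbabilityMeasure P] {U : Ω → F} {g : F → ℝ}
    {A₁ A₂ : ℝ} (hA : HasSlackTaylorBound g A₁ A₂) {q : Ω → ℝ} (hq : HasFiniteMoments q P)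
    (hU : HasFiniteMoments U P) {x : F} {h : ℝ}
    (hg : Integrable (fun ω => g (x - h • q ω • U ω)) P) :
    ∫ ω, g (x - h • q ω • U ω) ∂P ≤
      g x + A₂ - h * ∫ ω, q ω * fderiv ℝ g x (U ω) ∂P +
        A₁ / 2 * h ^ 2 * ∫ ω, q ω ^ 2 * ‖U ω‖ ^ 2 ∂P := by
  have hcorr := (hq.mul (hU.clm_comp (fderiv ℝ g x))).const_mul h
  have hsq := ((hq.pow 2).mul (hU.norm.pow 2)).const_mul (A₁ / 2 * h ^ 2)
  have hlin := (hasFiniteMoments_const (P := P) (g x + A₂)).sub hcorr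
  have hpointwise (ω : Ω) : g (x - h • q ω • U ω) ≤
      g x + A₂ - h * (q ω * fderiv ℝ g x (U ω)) +
        A₁ / 2 * h ^ 2 * (q ω ^ 2 * ‖U ω‖ ^ 2) := by
    have htaylor := (abs_le.mp (hA x (x - h • q ω • U ω))).2
    rw [sub_sub_cancel_left, norm_neg, map_neg, map_smul, map_smul, norm_smul, norm_smul,
      smul_eq_mul, smul_eq_mul, mul_pow, mul_pow, Real.norm_eq_abs, Real.norm_eq_abs, sq_abs,
      sq_abs] at htaylor
    linarith
  refine (integral_mono hg (hlin.add hsq).integrable hpointwise).trans_eq ?_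
  rw [integral_add hlin.integrable hsq.integrable, integral_sub (integrable_const _)
    hcorr.integrable, integral_const_mul, integral_const_mul, integral_const, probReal_univ,
    one_smul]

/-- One step of the random gradient method, seen as a function of the pair (iterate, direction). -/
noncomputable def gradStep [Module ℝ F] (f : F → ℝ) (μ h : ℝ) (p : F × F) : F :=
  p.1 - h • diffQuot f μ p.1 p.2 • p.2

section Moments

variable [NormedSpace ℝ F] [MeasurableSpace F] [BorelSpace F] {Ω : Type*} [MeasurableSpace Ω]
  {P : Measure Ω} {X U : Ω → F} {ftilde : F → ℝ}

lemma HasPolynomialGrowth.hasFiniteMoments_diffQuot [IsFiniteMeasure P]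
    (hg : HasPolynomialGrowth ftilde) (hm : Measurable ftilde) (μ : ℝ) (hX : HasFiniteMoments X P)
    (hU : HasFiniteMoments U P) : HasFiniteMoments (fun ω => diffQuot ftilde μ (X ω) (U ω)) P := by
  simpa only [diffQuot, div_eq_inv_mul] using
    ((hg.hasFiniteMoments_comp hm.stronglyMeasurable (hX.add (hU.const_smul μ))).sub
      (hg.hasFiniteMoments_comp hm.stronglyMeasurable hX)).const_mul μ⁻¹

lemma HasPolynomialGrowth.hasFiniteMoments_gradStep [IsFiniteMeasure P]
    (hg : HasPolynomialGrowth ftilde) (hm : Measurable ftilde) (μ h : ℝ)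
    (hX : HasFiniteMoments X P) (hU : HasFiniteMoments U P) :
    HasFiniteMoments (fun ω => gradStep ftilde μ h (X ω, U ω)) P :=
  hX.sub (((hg.hasFiniteMoments_diffQuot hm μ hX hU).smul hU).const_smul h)

end Moments

/-- The part of the bound on the second moment of the gradient estimate that does not involve the
gradient: `δ` bounds the noise of the function values, `M` the smoothing error, and `A₁`, `A₂` are
the constants of the quadratic bound with slack. -/
noncomputable def estimatorResidual (n : ℕ) (μ δ M A₁ A₂ : ℝ) : ℝ :=
  4 * δ ^ 2 / μ ^ 2 * n + 4 * M ^ 2 / μ ^ 2 * n + μ ^ 2 * A₁ ^ 2 / 4 * ((n : ℝ) + 6) ^ 3 +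
    A₂ ^ 2 / μ ^ 2 * n

variable [InnerProductSpace ℝ F] [FiniteDimensional ℝ F] [MeasurableSpace F] [BorelSpace F]
  {f ftilde : F → ℝ} {δ μ : ℝ}

lemma integral_diffQuot_sq_mul_norm_sq_le {g : F → ℝ} {M A₁ A₂ : ℝ}
    (hft : ∀ x, |f x - ftilde x| ≤ δ) (hg : ∀ x, |g x - f x| ≤ M)
    (hA : HasSlackTaylorBound g A₁ A₂) (hμ : 0 < μ) {x : F}
    (hq : HasFiniteMoments (diffQuot ftilde μ x) (stdGaussian F)) :
    ∫ u, diffQuot ftilde μ x u ^ 2 * ‖u‖ ^ 2 ∂stdGaussian F ≤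
      5 * ((Module.finrank ℝ F + 2) * ‖fderiv ℝ g x‖ ^ 2 +
        estimatorResidual (Module.finrank ℝ F) μ δ M A₁ A₂) := by
  have hid := hasFiniteMoments_id_stdGaussian (F := F)
  set s := fderiv ℝ g x
  set c := (2 * δ / μ) ^ 2 + (2 * M / μ) ^ 2 + (A₂ / μ) ^ 2 with hc
  have hpointwise (u : F) : diffQuot ftilde μ x u ^ 2 * ‖u‖ ^ 2 ≤
      5 * (c * ‖u‖ ^ 2 + s u ^ 2 * ‖u‖ ^ 2 + (μ * A₁ / 2) ^ 2 * ‖u‖ ^ 6) := by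
    have hsq := (sq_le_sq' (by linarith [neg_abs_le (diffQuot ftilde μ x u),
      abs_diffQuot_le_of_hasSlackTaylorBound hft hg hA hμ x u]) ((le_abs_self _).trans
      (abs_diffQuot_le_of_hasSlackTaylorBound hft hg hA hμ x u))).trans (sq_add_five_le _ _ _ _ _)
    rw [sq_abs] at hsq
    exact (mul_le_mul_of_nonneg_right hsq (sq_nonneg ‖u‖)).trans_eq (by rw [hc]; ring)
  have hconst := (hid.norm.pow 2).const_mul c
  have hgrad := ((hid.clm_comp s).pow 2).mul (hid.norm.pow 2)
  have hquad := (hid.norm.pow 6).const_mul ((μ * A₁ / 2) ^ 2)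
  calc ∫ u, diffQuot ftilde μ x u ^ 2 * ‖u‖ ^ 2 ∂stdGaussian F
      ≤ ∫ u, 5 * (c * ‖u‖ ^ 2 + s u ^ 2 * ‖u‖ ^ 2 + (μ * A₁ / 2) ^ 2 * ‖u‖ ^ 6) ∂stdGaussian F :=
        integral_mono ((hq.pow 2).mul (hid.norm.pow 2)).integrable
          (((hconst.add hgrad).add hquad).const_mul 5).integrable hpointwise
    _ = 5 * (c * Module.finrank ℝ F + (Module.finrank ℝ F + 2) * ‖s‖ ^ 2 +
          (μ * A₁ / 2) ^ 2 * ∫ u : F, ‖u‖ ^ 6 ∂stdGaussian F) := by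
        rw [integral_const_mul, integral_add (hconst.add hgrad).integrable hquad.integrable,
          integral_add hconst.integrable hgrad.integrable, integral_const_mul,
          integral_const_mul, integral_norm_sq_stdGaussian,
          integral_apply_sq_mul_norm_sq_stdGaussian]
    _ ≤ 5 * (c * Module.finrank ℝ F + (Module.finrank ℝ F + 2) * ‖s‖ ^ 2 +
          (μ * A₁ / 2) ^ 2 * (Module.finrank ℝ F + 6 : ℝ) ^ 3) := by
        gcongr
        exact integral_norm_pow_six_stdGaussian_le
    _ = 5 * ((Module.finrank ℝ F + 2) * ‖s‖ ^ 2 +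
          estimatorResidual (Module.finrank ℝ F) μ δ M A₁ A₂) := by
        rw [hc, estimatorResidual]
        ring

lemma integral_diffQuot_mul_fderiv_gaussSmooth (hd : Differentiable ℝ f)
    (hf' : HasPolynomialGrowth (fderiv ℝ f)) (hμ : 0 < μ) (x : F) :
    ∫ u, diffQuot f μ x u * fderiv ℝ (gaussSmooth f μ) x u ∂stdGaussian F =
      ‖fderiv ℝ (gaussSmooth f μ) x‖ ^ 2 := by
  have hid := hasFiniteMoments_id_stdGaussian (F := F)
  obtain ⟨e, he⟩ := (InnerProductSpace.toDual ℝ F).surjective (fderiv ℝ (gaussSmooth f μ) x)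
  have happly (u : F) : fderiv ℝ (gaussSmooth f μ) x u = inner ℝ e u := by
    rw [← he, InnerProductSpace.toDual_apply_apply]
  have hfx := (HasPolynomialGrowth.of_fderiv hd hf').hasFiniteMoments_comp_add_smul
    hd.continuous.stronglyMeasurable μ x
  have hmean : ∫ u, inner ℝ e u ∂stdGaussian F = 0 :=
    integral_strongDual_stdGaussian (innerSL ℝ e)
  calc ∫ u, diffQuot f μ x u * fderiv ℝ (gaussSmooth f μ) x u ∂stdGaussian F
      = ∫ u, μ⁻¹ * (inner ℝ e u * f (x + μ • u) - f x * inner ℝ e u) ∂stdGaussian F := by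
        congr 1 with u
        rw [diffQuot, happly]
        ring
    _ = μ⁻¹ * (μ * fderiv ℝ (gaussSmooth f μ) x e) := by
        rw [integral_const_mul, integral_sub ((hid.inner e).mul hfx).integrable
          ((hid.inner e).const_mul _).integrable, integral_const_mul, hmean, mul_zero, sub_zero,
          mul_fderiv_gaussSmooth_apply hd hf']
    _ = ‖fderiv ℝ (gaussSmooth f μ) x‖ ^ 2 := by
        rw [inv_mul_cancel_left₀ hμ.ne', happly, real_inner_self_eq_norm_sq, ← he,
          LinearIsometryEquiv.norm_map]

lemma le_integral_diffQuot_mul_fderiv_gaussSmooth (hd : Differentiable ℝ f)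
    (hf' : HasPolynomialGrowth (fderiv ℝ f)) (hm : Measurable ftilde)
    (hft : ∀ x, |f x - ftilde x| ≤ δ) (hμ : 0 < μ) (x : F) :
    3 / 4 * ‖fderiv ℝ (gaussSmooth f μ) x‖ ^ 2 - 4 * δ ^ 2 / μ ^ 2 * Module.finrank ℝ F ≤
      ∫ u, diffQuot ftilde μ x u * fderiv ℝ (gaussSmooth f μ) x u ∂stdGaussian F := by
  have hid := hasFiniteMoments_id_stdGaussian (F := F)
  have hx := hasFiniteMoments_const (P := stdGaussian F) x
  have hfgrowth := HasPolynomialGrowth.of_fderiv hd hf'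
  set s := fderiv ℝ (gaussSmooth f μ) x
  have hpointwise (u : F) :
      diffQuot f μ x u * s u - (4 * δ ^ 2 / μ ^ 2 * ‖u‖ ^ 2 + ‖s‖ ^ 2 / 4) ≤
        diffQuot ftilde μ x u * s u := by
    have hnoise : |(diffQuot ftilde μ x u - diffQuot f μ x u) * s u| ≤
        2 * δ / μ * (‖s‖ * ‖u‖) := by
      rw [abs_mul]
      have hq := abs_diffQuot_sub_diffQuot_le hft hμ x u
      exact mul_le_mul hq (s.le_opNorm u) (abs_nonneg _) ((abs_nonneg _).trans hq)
    have hyoung : 2 * δ / μ * (‖s‖ * ‖u‖) ≤ 4 * δ ^ 2 / μ ^ 2 * ‖u‖ ^ 2 + ‖s‖ ^ 2 / 4 := by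
      rw [show 4 * δ ^ 2 / μ ^ 2 * ‖u‖ ^ 2 = (2 * δ / μ * ‖u‖) ^ 2 by ring]
      nlinarith [sq_nonneg (2 * δ / μ * ‖u‖ - ‖s‖ / 2)]
    linarith [(abs_le.mp hnoise).1]
  have hexact := (hfgrowth.hasFiniteMoments_diffQuot hd.continuous.measurable μ hx hid).mul
    (hid.clm_comp s)
  have hnoisy := ((hfgrowth.of_norm_sub_le hft).hasFiniteMoments_diffQuot hm μ hx hid).mul
    (hid.clm_comp s)
  have hsq := (hid.norm.pow 2).const_mul (4 * δ ^ 2 / μ ^ 2)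
  have herror := hsq.add (hasFiniteMoments_const (‖s‖ ^ 2 / 4))
  refine le_trans (le_of_eq ?_)
    (integral_mono (hexact.sub herror).integrable hnoisy.integrable hpointwise)
  rw [integral_sub hexact.integrable herror.integrable, integral_add hsq.integrable
    (integrable_const _), integral_const_mul,
    integral_norm_sq_stdGaussian, integral_diffQuot_mul_fderiv_gaussSmooth hd hf' hμ,
    integral_const, probReal_univ, one_smul]
  ring

lemma integral_gaussSmooth_gradStep_le (hd : Differentiable ℝ f)
    (hf' : HasPolynomialGrowth (fderiv ℝ f)) (hm : Measurable ftilde)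
    (hft : ∀ x, |f x - ftilde x| ≤ δ) (hμ : 0 < μ) {M A₁ A₂ A₁' A₂' h : ℝ}
    (hM : ∀ x, |gaussSmooth f μ x - f x| ≤ M) (hA : HasSlackTaylorBound (gaussSmooth f μ) A₁ A₂)
    (hA' : HasSlackTaylorBound (gaussSmooth f μ) A₁' A₂') (hA₁ : 0 ≤ A₁) (hh0 : 0 ≤ h)
    (hh : 5 * h * A₁ * (Module.finrank ℝ F + 2) ≤ 1) (x : F) :
    ∫ u, gaussSmooth f μ (gradStep ftilde μ h (x, u)) ∂stdGaussian F ≤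
      gaussSmooth f μ x - h / 4 * ‖fderiv ℝ (gaussSmooth f μ) x‖ ^ 2 +
        (h * (4 * δ ^ 2 / μ ^ 2 * Module.finrank ℝ F + 5 / 2 * A₁ * h *
          estimatorResidual (Module.finrank ℝ F) μ δ M A₁' A₂') + A₂) := by
  have hid := hasFiniteMoments_id_stdGaussian (F := F)
  have hx := hasFiniteMoments_const (P := stdGaussian F) x
  have hfgrowth := HasPolynomialGrowth.of_fderiv hd hf'
  have hftgrowth := hfgrowth.of_norm_sub_le hft
  have hgrowth := hfgrowth.of_norm_sub_le fun x => (abs_sub_comm _ _).trans_le (hM x)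
  have hq := hftgrowth.hasFiniteMoments_diffQuot hm μ hx hid
  have hstep := hgrowth.hasFiniteMoments_comp
    (differentiable_gaussSmooth hd hf' μ).continuous.stronglyMeasurable
    (hftgrowth.hasFiniteMoments_gradStep hm μ h hx hid)
  have hdescent := hA.integral_comp_sub_smul_le hq hid hstep.integrable
  have hcorr := mul_le_mul_of_nonneg_left
    (le_integral_diffQuot_mul_fderiv_gaussSmooth hd hf' hm hft hμ x) hh0
  have hsecond := mul_le_mul_of_nonneg_left
    (integral_diffQuot_sq_mul_norm_sq_le hft hM hA' hμ hq) (by positivity : 0 ≤ A₁ / 2 * h ^ 2)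
  have habsorb := mul_le_mul_of_nonneg_right hh
    (by positivity : 0 ≤ h / 2 * ‖fderiv ℝ (gaussSmooth f μ) x‖ ^ 2)
  unfold gradStep
  linarith

end Estimator

section DrivenProcess

variable {α β Ω : Type*} {Φ : α × β → α} {N : ℕ} {v : Fin N → Ω → β} {a : α} {y : ℕ → Ω → α}

/-- The process `y` starts at the point `a`, and its first `N` steps are driven by the innovations
`v` through the transition map `Φ`. Nothing is required of `y` after time `N`. -/
structure IsDrivenBy (Φ : α × β → α) (v : Fin N → Ω → β) (a : α) (y : ℕ → Ω → α) : Prop where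
  zero : ∀ ω, y 0 ω = a
  succ : ∀ (k : Fin N) (ω : Ω), y (k + 1) ω = Φ (y k ω, v k ω)

variable [MeasurableSpace α] [MeasurableSpace β]

lemma IsDrivenBy.measurable_iSup_comap (hy : IsDrivenBy Φ v a y) (hΦ : Measurable Φ) {k : ℕ}
    (hk : k ≤ N) :
    Measurable[⨆ j ∈ {j : Fin N | (j : ℕ) < k}, MeasurableSpace.comap (v j) inferInstance]
      (y k) := by
  induction k with
  | zero =>
    rw [funext hy.zero]
    exact measurable_const
  | succ k ih =>
    rw [funext (hy.succ ⟨k, hk⟩)]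
    have hpast := (ih (Nat.le_of_succ_le hk)).mono (biSup_mono fun j (hj : (j : ℕ) < k) =>
      (Nat.lt_succ_of_lt hj : j ∈ {j : Fin N | (j : ℕ) < k + 1})) le_rfl
    have hmem : (⟨k, hk⟩ : Fin N) ∈ {j : Fin N | (j : ℕ) < k + 1} := Nat.lt_succ_self k
    have hnew := (comap_measurable (v ⟨k, hk⟩)).mono
      (le_biSup (fun j : Fin N => MeasurableSpace.comap (v j) inferInstance) hmem) le_rfl
    exact hΦ.comp (hpast.prodMk hnew)

variable [MeasurableSpace Ω] {P : Measure Ω}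

lemma IsDrivenBy.measurable (hy : IsDrivenBy Φ v a y) (hΦ : Measurable Φ)
    (hv : ∀ k, Measurable (v k)) {k : ℕ} (hk : k ≤ N) : Measurable (y k) :=
  (hy.measurable_iSup_comap hΦ hk).mono (iSup₂_le fun j _ => (hv j).comap_le) le_rfl

lemma IsDrivenBy.indepFun (hy : IsDrivenBy Φ v a y) (hΦ : Measurable Φ)
    (hv : ∀ k, Measurable (v k)) (hind : iIndepFun v P) (k : Fin N) :
    IndepFun (y k) (v k) P := by
  have hdisj : Disjoint {j : Fin N | (j : ℕ) < k} {k} := by simp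
  refine indep_of_indep_of_le_left (indep_of_indep_of_le_right
    (indep_iSup_of_disjoint (fun j => (hv j).comap_le) hind hdisj) (by simp)) ?_
  exact (hy.measurable_iSup_comap hΦ k.2.le).comap_le

lemma integral_comp_prodMk_le_of_indepFun [IsFiniteMeasure P] {X : Ω → α} {U : Ω → β}
    (hX : Measurable X) (hU : Measurable U) (hXU : IndepFun X U P) {H : α × β → ℝ} {W : α → ℝ}
    (hH : Measurable H) (hW : Measurable W) (hHi : Integrable (fun ω => H (X ω, U ω)) P)
    (hWi : Integrable (fun ω => W (X ω)) P) (hle : ∀ x, ∫ u, H (x, u) ∂P.map U ≤ W x) :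
    ∫ ω, H (X ω, U ω) ∂P ≤ ∫ ω, W (X ω) ∂P := by
  have hlaw := (indepFun_iff_map_prod_eq_prod_map_map hX.aemeasurable hU.aemeasurable).mp hXU
  have hHlaw : Integrable H ((P.map X).prod (P.map U)) := by
    rw [← hlaw]
    exact (integrable_map_measure hH.aestronglyMeasurable (hX.prodMk hU).aemeasurable).mpr hHi
  calc ∫ ω, H (X ω, U ω) ∂P = ∫ x, ∫ u, H (x, u) ∂P.map U ∂P.map X := by
        rw [← integral_prod _ hHlaw, ← hlaw,
          integral_map (hX.prodMk hU).aemeasurable hH.aestronglyMeasurable]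
    _ ≤ ∫ x, W x ∂P.map X := integral_mono hHlaw.integral_prod_left
        ((integrable_map_measure hW.aestronglyMeasurable hX.aemeasurable).mpr hWi) hle
    _ = ∫ ω, W (X ω) ∂P := integral_map hX.aemeasurable hW.aestronglyMeasurable

lemma IsDrivenBy.integral_add_sum_le [IsProbabilityMeasure P] (hy : IsDrivenBy Φ v a y)
    (hΦ : Measurable Φ) (hv : ∀ k, Measurable (v k)) (hind : iIndepFun v P) {V G : α → ℝ} {R : ℝ}
    (hV : Measurable V) (hG : Measurable G)
    (hVi : ∀ k ≤ N, Integrable (fun ω => V (y k ω)) P)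
    (hGi : ∀ k < N, Integrable (fun ω => G (y k ω)) P)
    (hdrift : ∀ (k : Fin N) (x : α), ∫ u, V (Φ (x, u)) ∂P.map (v k) ≤ V x - G x + R) :
    ∫ ω, V (y N ω) ∂P + ∑ k ∈ Finset.range N, ∫ ω, G (y k ω) ∂P ≤ V a + N * R := by
  have hstep (k : Fin N) : ∫ ω, V (y (k + 1) ω) ∂P ≤
      ∫ ω, V (y k ω) ∂P - ∫ ω, G (y k ω) ∂P + R := by
    have hVk := hVi k k.2.le
    have hGk := hGi k k.2
    have hVGk : Integrable (fun ω => V (y k ω) - G (y k ω)) P := hVk.sub hGk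
    have hnext := hVi (k + 1) k.2
    simp only [hy.succ] at hnext ⊢
    refine (integral_comp_prodMk_le_of_indepFun (hy.measurable hΦ hv k.2.le) (hv k)
      (hy.indepFun hΦ hv hind k) (W := fun x => V x - G x + R) (hV.comp hΦ)
      ((hV.sub hG).add_const R) hnext
      (hVGk.add (integrable_const R)) (hdrift k)).trans_eq ?_
    rw [integral_add hVGk (integrable_const R), integral_sub hVk hGk, integral_const,
      probReal_univ, one_smul]
  have hsum : ∀ k ≤ N, ∫ ω, V (y k ω) ∂P + ∑ i ∈ Finset.range k, ∫ ω, G (y i ω) ∂P ≤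
      V a + k * R := by
    intro k hk
    induction k with
    | zero => simp [hy.zero]
    | succ k ih =>
      rw [Finset.sum_range_succ, Nat.cast_succ]
      linarith [ih (Nat.le_of_succ_le hk), hstep ⟨k, hk⟩]
  exact hsum N le_rfl

end DrivenProcess

section GradientMethod

variable {F : Type*} [NormedAddCommGroup F] [MeasurableSpace F] [BorelSpace F] {Ω : Type*}
  [MeasurableSpace Ω] {P : Measure Ω} {f ftilde : F → ℝ} {δ μ h : ℝ}
  {N : ℕ} {v : Fin N → Ω → F} {a : F} {y : ℕ → Ω → F}

lemma measurable_gradStep [NormedSpace ℝ F] [SecondCountableTopology F]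
    (hm : Measurable ftilde) (μ h : ℝ) : Measurable (gradStep ftilde μ h) := by
  unfold gradStep diffQuot
  fun_prop

lemma IsDrivenBy.hasFiniteMoments [NormedSpace ℝ F] [IsFiniteMeasure P]
    (hy : IsDrivenBy (gradStep ftilde μ h) v a y) (hg : HasPolynomialGrowth ftilde)
    (hm : Measurable ftilde) (hv : ∀ k, HasFiniteMoments (v k) P) {k : ℕ} (hk : k ≤ N) :
    HasFiniteMoments (y k) P := by
  induction k with
  | zero =>
    rw [funext hy.zero]
    exact hasFiniteMoments_const a
  | succ k ih =>
    rw [funext (hy.succ ⟨k, hk⟩)]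
    exact hg.hasFiniteMoments_gradStep hm μ h (ih (Nat.le_of_succ_le hk)) (hv ⟨k, hk⟩)

variable [InnerProductSpace ℝ F] [FiniteDimensional ℝ F] {L ν : ℝ≥0}

lemma HasFiniteMoments.fderiv_gaussSmooth [IsFiniteMeasure P] (hd : Differentiable ℝ f)
    (hf' : HolderWith L ν (fderiv ℝ f)) {Z : Ω → F} (hZ : HasFiniteMoments Z P) :
    HasFiniteMoments (fun ω => fderiv ℝ (gaussSmooth f μ) (Z ω)) P := by
  have hmeas : StronglyMeasurable (fderiv ℝ f) := (measurable_fderiv ℝ f).stronglyMeasurable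
  refine HasPolynomialGrowth.hasFiniteMoments_comp (.of_holderWith (C := L) (r := ν) ?_)
    (measurable_fderiv ℝ _).stronglyMeasurable hZ
  rw [ZerothOrder.fderiv_gaussSmooth hd (.of_holderWith hf')]
  exact holderWith_gaussSmooth hf' hmeas μ

variable [IsProbabilityMeasure P]

lemma IsDrivenBy.integrable_norm_fderiv_gaussSmooth_sq
    (hy : IsDrivenBy (gradStep ftilde μ h) v a y) (hd : Differentiable ℝ f)
    (hf' : HolderWith L ν (fderiv ℝ f)) (hg : HasPolynomialGrowth ftilde) (hm : Measurable ftilde)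
    (hv : ∀ k, HasFiniteMoments (v k) P) {k : ℕ} (hk : k ≤ N) :
    Integrable (fun ω => ‖fderiv ℝ (gaussSmooth f μ) (y k ω)‖ ^ 2) P :=
  (((hy.hasFiniteMoments hg hm hv hk).fderiv_gaussSmooth hd hf').norm.pow 2).integrable

lemma IsDrivenBy.mul_sum_integral_norm_fderiv_gaussSmooth_sq_le
    (hy : IsDrivenBy (gradStep ftilde μ h) v a y) (hd : Differentiable ℝ f)
    (hf' : HolderWith L ν (fderiv ℝ f)) {c : ℝ} (hc : ∀ x, c ≤ f x) (hm : Measurable ftilde)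
    (hft : ∀ x, |f x - ftilde x| ≤ δ) (hμ : 0 < μ) {M A₁ A₂ A₁' A₂' : ℝ}
    (hM : ∀ x, |gaussSmooth f μ x - f x| ≤ M) (hA : HasSlackTaylorBound (gaussSmooth f μ) A₁ A₂)
    (hA' : HasSlackTaylorBound (gaussSmooth f μ) A₁' A₂') (hA₁ : 0 ≤ A₁) (hh0 : 0 ≤ h)
    (hh : 5 * h * A₁ * (Module.finrank ℝ F + 2) ≤ 1)
    (hv : ∀ k, Measurable (v k)) (hlaw : ∀ k, P.map (v k) = stdGaussian F)
    (hind : iIndepFun v P) :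
    h / 4 * ∑ k ∈ Finset.range N, ∫ ω, ‖fderiv ℝ (gaussSmooth f μ) (y k ω)‖ ^ 2 ∂P ≤
      gaussSmooth f μ a - c + N * (h * (4 * δ ^ 2 / μ ^ 2 * Module.finrank ℝ F +
        5 / 2 * A₁ * h * estimatorResidual (Module.finrank ℝ F) μ δ M A₁' A₂') + A₂) := by
  have hfder : HasPolynomialGrowth (fderiv ℝ f) := .of_holderWith hf'
  have hfgrowth := HasPolynomialGrowth.of_fderiv hd hfder
  have hgrowth := hfgrowth.of_norm_sub_le fun x => (abs_sub_comm _ _).trans_le (hM x)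
  have hsmooth := (differentiable_gaussSmooth hd hfder μ).continuous
  have hv_moments (k : Fin N) : HasFiniteMoments (v k) P :=
    .of_map_eq_stdGaussian (hv k).aemeasurable (hlaw k)
  have hftgrowth := hfgrowth.of_norm_sub_le hft
  have hVi (k : ℕ) (hk : k ≤ N) : Integrable (fun ω => gaussSmooth f μ (y k ω)) P :=
    (hgrowth.hasFiniteMoments_comp hsmooth.stronglyMeasurable
      (hy.hasFiniteMoments hftgrowth hm hv_moments hk)).integrable
  have htelescope := hy.integral_add_sum_le (measurable_gradStep hm μ h) hv hind
    hsmooth.measurable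
    (((measurable_fderiv ℝ (gaussSmooth f μ)).norm.pow_const 2).const_mul (h / 4)) hVi
    (fun k hk => (hy.integrable_norm_fderiv_gaussSmooth_sq hd hf' hftgrowth hm hv_moments
      hk.le).const_mul (h / 4))
    fun k x => by
      rw [hlaw]
      exact integral_gaussSmooth_gradStep_le hd hfder hm hft hμ hM hA hA' hA₁ hh0 hh x
  have hlower : c ≤ ∫ ω, gaussSmooth f μ (y N ω) ∂P := by
    simpa using integral_mono (integrable_const c) (hVi N le_rfl)
      fun ω => le_gaussSmooth hfgrowth hd.continuous.stronglyMeasurable hc μ (y N ω)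
  simp only [integral_const_mul, ← Finset.mul_sum] at htelescope
  linarith

lemma mul_inf'_le_sum {ι : Type*} {s : Finset ι} (hs : s.Nonempty) (G : ι → ℝ) :
    s.card * s.inf' hs G ≤ ∑ i ∈ s, G i := by
  simpa only [nsmul_eq_mul] using
    Finset.card_nsmul_le_sum s G (s.inf' hs G) fun i hi => Finset.inf'_le G hi

lemma le_of_step_mul_le {n A₁ A₂ D h N m Δ δ μ X : ℝ} (hn : 0 ≤ n) (hA₁ : 0 < A₁)
    (hD0 : 0 < D) (hD1 : D ≤ 1) (hh : h = D / (80 * (n + 4) * A₁)) (hN : 0 < N) (hX : 0 ≤ X)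
    (hm : h / 4 * (N * m) ≤
      Δ + N * (h * (4 * δ ^ 2 / μ ^ 2 * n + 5 / 2 * A₁ * h * X) + A₂)) :
    m ≤ 320 * (n + 4) * A₁ * Δ / (N * D) + D / (4 * (n + 4)) * X +
      320 * (n + 4) * A₁ / D * (A₂ + δ ^ 2 / (2 * A₁ * μ ^ 2) * n + δ ^ 2 / μ ^ 2 * n) := by
  have hh0 : 0 < h := by
    rw [hh]
    positivity
  set q := δ ^ 2 / μ ^ 2 * n with hq
  have hq0 : 0 ≤ q := by positivity
  have hnD : 1 ≤ (n + 4) / D := by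
    rw [one_le_div hD0]
    linarith
  calc m ≤ (Δ + N * (h * (4 * δ ^ 2 / μ ^ 2 * n + 5 / 2 * A₁ * h * X) + A₂)) / (h / 4 * N) := by
        rw [le_div_iff₀ (by positivity)]
        linarith
    _ = 320 * (n + 4) * A₁ * Δ / (N * D) + D / (8 * (n + 4)) * X +
          (320 * (n + 4) * A₁ / D * A₂ + 16 * q) := by
        rw [hh, hq]
        field_simp
        ring
    _ ≤ 320 * (n + 4) * A₁ * Δ / (N * D) + D / (4 * (n + 4)) * X +
          (320 * (n + 4) * A₁ / D * A₂ + 160 * ((n + 4) / D) * q +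
            320 * (n + 4) * A₁ / D * q) := by
        have hslack : 0 ≤ 320 * (n + 4) * A₁ / D * q := mul_nonneg (by positivity) hq0
        have hnoise : 16 * q ≤ 160 * ((n + 4) / D) * q := by
          gcongr
          linarith
        have hresidual : D / (8 * (n + 4)) * X ≤ D / (4 * (n + 4)) * X := by
          gcongr
          norm_num
        linarith
    _ = 320 * (n + 4) * A₁ * Δ / (N * D) + D / (4 * (n + 4)) * X +
          320 * (n + 4) * A₁ / D * (A₂ + δ ^ 2 / (2 * A₁ * μ ^ 2) * n + q) := by
        rw [hq]
        field_simp
        ring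

lemma estimatorResidual_nonneg (n : ℕ) (μ δ M A₁ A₂ : ℝ) :
    0 ≤ estimatorResidual n μ δ M A₁ A₂ := by
  unfold estimatorResidual
  positivity

lemma estimatorResidual_of_holder {ν μ : ℝ} (hν : 0 ≤ ν) (hμ : 0 < μ) (n : ℕ) (L δ A₁ A₂ : ℝ) :
    estimatorResidual n μ δ (L * μ ^ (1 + ν) / (1 + ν) * (n : ℝ) ^ ((1 + ν) / 2)) A₁ A₂ =
      4 * δ ^ 2 / μ ^ 2 * n + 4 * L ^ 2 / (1 + ν) ^ 2 * μ ^ (2 * ν) * (n : ℝ) ^ (2 + ν) +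
        μ ^ 2 * A₁ ^ 2 / 4 * ((n : ℝ) + 6) ^ 3 + A₂ ^ 2 / μ ^ 2 * n := by
  have hn : ((n : ℝ) ^ ((1 + ν) / 2)) ^ 2 * n = (n : ℝ) ^ (2 + ν) := by
    rw [← Real.rpow_mul_natCast n.cast_nonneg, ← Real.rpow_add_one' n.cast_nonneg (by positivity)]
    congr 1
    push_cast
    ring
  have hμν : (μ ^ (1 + ν)) ^ 2 = μ ^ (2 * ν) * μ ^ 2 := by
    rw [← Real.rpow_mul_natCast hμ.le, ← Real.rpow_add_natCast hμ.ne']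
    congr 1
    push_cast
    ring
  rw [estimatorResidual, ← hn, mul_pow, div_pow, mul_pow, hμν]
  field_simp

theorem IsDrivenBy.inf'_integral_norm_fderiv_gaussSmooth_sq_le
    (hy : IsDrivenBy (gradStep ftilde μ h) v a y) (hd : Differentiable ℝ f)
    (hf' : HolderWith L ν (fderiv ℝ f)) (hν : ν ≤ 1) {c : ℝ} (hc : ∀ x, c ≤ f x)
    (hm : Measurable ftilde) (hft : ∀ x, |f x - ftilde x| ≤ δ) (hμ : 0 < μ)
    {n : ℕ} (hn : Module.finrank ℝ F = n) {A₁ A₂ A₁' A₂' D : ℝ} (hA : IsSlackPair n ν L μ A₁ A₂)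
    (hA' : IsSlackPair n ν L μ A₁' A₂') (hA₁ : 0 < A₁) (hD0 : 0 < D) (hD1 : D ≤ 1)
    (hh : h = D / (80 * ((n : ℝ) + 4) * A₁)) (hN : 0 < N)
    (hv : ∀ k, Measurable (v k)) (hlaw : ∀ k, P.map (v k) = stdGaussian F)
    (hind : iIndepFun v P) :
    (Finset.range N).inf' (Finset.nonempty_range_iff.mpr hN.ne') (fun k =>
        ∫ ω, ‖fderiv ℝ (gaussSmooth f μ) (y k ω)‖ ^ 2 ∂P) ≤
      320 * ((n : ℝ) + 4) * A₁ * (gaussSmooth f μ a - c) / (N * D)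
      + D / (4 * ((n : ℝ) + 4)) *
        (4 * δ ^ 2 / μ ^ 2 * n
          + 4 * L ^ 2 / (1 + ν) ^ 2 * μ ^ (2 * ν : ℝ) * (n : ℝ) ^ (2 + ν : ℝ)
          + μ ^ 2 * A₁' ^ 2 / 4 * ((n : ℝ) + 6) ^ 3
          + A₂' ^ 2 / μ ^ 2 * n)
      + 320 * ((n : ℝ) + 4) * A₁ / D *
        (A₂ + δ ^ 2 / (2 * A₁ * μ ^ 2) * n + δ ^ 2 / μ ^ 2 * n) := by
  subst hn
  have hh0 : 0 ≤ h := by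
    rw [hh]
    positivity
  have hsmall : 5 * h * A₁ * (Module.finrank ℝ F + 2) ≤ 1 := by
    have hcancel : 5 * h * A₁ * (Module.finrank ℝ F + 2) =
        D * (Module.finrank ℝ F + 2) / (16 * (Module.finrank ℝ F + 4)) := by
      rw [hh]
      field_simp
      ring
    rw [hcancel, div_le_one (by positivity)]
    nlinarith
  have hsum := hy.mul_sum_integral_norm_fderiv_gaussSmooth_sq_le hd hf' hc hm hft hμ
    (abs_gaussSmooth_sub_le hd hf' hν hμ.le) (hA.hasSlackTaylorBound_gaussSmooth hd hf' hν hμ)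
    (hA'.hasSlackTaylorBound_gaussSmooth hd hf' hν hμ) hA₁.le hh0 hsmall hv hlaw hind
  have hmin := mul_inf'_le_sum (Finset.nonempty_range_iff.mpr hN.ne')
    fun k => ∫ ω, ‖fderiv ℝ (gaussSmooth f μ) (y k ω)‖ ^ 2 ∂P
  rw [Finset.card_range] at hmin
  rw [← estimatorResidual_of_holder ν.coe_nonneg hμ]
  exact le_of_step_mul_le (Nat.cast_nonneg _) hA₁ hD0 hD1 hh (Nat.cast_pos.mpr hN)
    (estimatorResidual_nonneg _ _ _ _ _ _)
    ((mul_le_mul_of_nonneg_left hmin (by positivity)).trans hsum)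

end GradientMethod

/- `E` carries no topology here, so that the inner product `b` can provide its norm. -/
lemma exists_linearEquiv_euclideanSpace {E : Type*} [AddCommGroup E] [Module ℝ E]
    [FiniteDimensional ℝ E] (b : E →ₗ[ℝ] E →ₗ[ℝ] ℝ) (hsymm : ∀ x y, b x y = b y x)
    (hpos : ∀ x, x ≠ 0 → 0 < b x x) :
    ∃ T : E ≃ₗ[ℝ] EuclideanSpace ℝ (Fin (Module.finrank ℝ E)),
      ∀ x y, inner ℝ (T x) (T y) = b x y := by
  let core : InnerProductSpace.Core ℝ E :=
    { inner := fun x y => b x y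
      conj_inner_symm := fun x y => hsymm y x
      re_inner_nonneg := fun x => by
        rcases eq_or_ne x 0 with rfl | hx
        · simp
        · exact (hpos x hx).le
      add_left := fun x y z => by rw [map_add, LinearMap.add_apply]
      smul_left := fun x y r => by simp
      definite := fun x hx => by
        by_contra h
        exact (hpos x h).ne' hx }
  let _ : NormedAddCommGroup E := core.toNormedAddCommGroup
  let _ : InnerProductSpace ℝ E := InnerProductSpace.ofCore core.toCore
  exact ⟨(stdOrthonormalBasis ℝ E).repr.toLinearEquiv,
    (stdOrthonormalBasis ℝ E).repr.inner_map_map⟩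

section Transfer

variable {E : Type*} [NormedAddCommGroup E] [NormedSpace ℝ E]
  {F : Type*} [NormedAddCommGroup F] [InnerProductSpace ℝ F]
  {B : E ≃L[ℝ] StrongDual ℝ E} {T : E ≃L[ℝ] F}

lemma exists_continuousLinearEquiv_euclideanSpace [FiniteDimensional ℝ E]
    (hsymm : ∀ x y, B x y = B y x) (hpos : ∀ x, x ≠ 0 → 0 < B x x) :
    ∃ T : E ≃L[ℝ] EuclideanSpace ℝ (Fin (Module.finrank ℝ E)),
      ∀ x y, inner ℝ (T x) (T y) = B x y := by
  obtain ⟨T, hT⟩ := exists_linearEquiv_euclideanSpace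
    (ContinuousLinearMap.coeLM ℝ ∘ₗ (B : E →L[ℝ] StrongDual ℝ E).toLinearMap) hsymm hpos
  exact ⟨T.toContinuousLinearEquiv, hT⟩

lemma primalNorm_eq_norm (hT : ∀ x y, inner ℝ (T x) (T y) = B x y) (x : E) :
    primalNorm B x = ‖T x‖ := by
  rw [primalNorm, ← hT, real_inner_self_eq_norm_sq, Real.sqrt_sq (norm_nonneg _)]

lemma dualNorm_eq_norm [CompleteSpace F] (hT : ∀ x y, inner ℝ (T x) (T y) = B x y)
    (s : StrongDual ℝ E) : dualNorm B s = ‖s.comp (T.symm : F →L[ℝ] E)‖ := by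
  obtain ⟨w, hw⟩ := (InnerProductSpace.toDual ℝ F).surjective (s.comp (T.symm : F →L[ℝ] E))
  have hs (x : E) : s x = inner ℝ w (T x) := by
    simpa using (DFunLike.congr_fun hw (T x)).symm
  have hB : B.symm s = T.symm w := by
    rw [ContinuousLinearEquiv.symm_apply_eq]
    ext x
    rw [hs, ← hT, T.apply_symm_apply]
  rw [dualNorm, hB, hs, T.apply_symm_apply, ← hw, LinearIsometryEquiv.norm_map,
    real_inner_self_eq_norm_sq, Real.sqrt_sq (norm_nonneg _)]

lemma holderWith_fderiv_comp_symm [CompleteSpace F] (hT : ∀ x y, inner ℝ (T x) (T y) = B x y)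
    {f : E → ℝ} {L ν : ℝ≥0} (hf' : ∀ x y : E, dualNorm B (fderiv ℝ f y - fderiv ℝ f x) ≤
      L * primalNorm B (y - x) ^ (ν : ℝ)) :
    HolderWith L ν (fderiv ℝ (f ∘ T.symm)) := by
  refine holderWith_of_norm_sub_le fun x y => ?_
  have h := hf' (T.symm y) (T.symm x)
  rw [dualNorm_eq_norm hT, primalNorm_eq_norm hT, map_sub, T.apply_symm_apply,
    T.apply_symm_apply, ContinuousLinearMap.sub_comp] at h
  rwa [T.symm.comp_right_fderiv, T.symm.comp_right_fderiv]

lemma isDrivenBy_gradStep_of_gradEst {Ω : Type*} {N : ℕ} {ftilde : E → ℝ} {μ h : ℝ}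
    {u : Fin N → Ω → E} {x₀ : E} {x : ℕ → Ω → E} (hx_zero : ∀ ω, x 0 ω = x₀)
    (hx_succ : ∀ (k : Fin N) (ω : Ω), x ((k : ℕ) + 1) ω =
      x k ω - h • B.symm (gradEst B ftilde μ (x k ω) (u k ω))) :
    IsDrivenBy (gradStep (ftilde ∘ T.symm) μ h) (fun k ω => T (u k ω)) (T x₀)
      (fun k ω => T (x k ω)) where
  zero ω := by rw [hx_zero]
  succ k ω := by
    simp only [hx_succ k ω, gradEst, gradStep, diffQuot, Function.comp_apply, map_sub, map_add,
      map_smul, T.symm_apply_apply, B.symm_apply_apply]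

variable [FiniteDimensional ℝ E] [MeasurableSpace E] [BorelSpace E]
  [MeasurableSpace F] [BorelSpace F]

lemma integral_map_addHaar (g : F → ℝ) :
    ∫ z, g z ∂((Measure.addHaar : Measure E).map T) = ∫ u : E, g (T u) ∂Measure.addHaar :=
  T.toHomeomorph.measurableEmbedding.integral_map g

lemma kappa_eq (hT : ∀ x y, inner ℝ (T x) (T y) = B x y) :
    kappa B = ∫ z, Real.exp (-(1 / 2) * ‖z‖ ^ 2) ∂((Measure.addHaar : Measure E).map T) := by
  simp only [integral_map_addHaar, kappa, gaussWeight, primalNorm_eq_norm hT]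

lemma one_div_kappa_mul_gaussWeight (hT : ∀ x y, inner ℝ (T x) (T y) = B x y) (v : E) :
    1 / kappa B * gaussWeight B v =
      gaussDensity ((Measure.addHaar : Measure E).map T) (T v) := by
  rw [gaussDensity, ← kappa_eq hT, gaussWeight, primalNorm_eq_norm hT]

variable [FiniteDimensional ℝ F]

lemma map_stdGaussianLaw (hT : ∀ x y, inner ℝ (T x) (T y) = B x y) :
    (stdGaussianLaw B).map T = stdGaussian F := by
  have : ((Measure.addHaar : Measure E).map T).IsAddHaarMeasure := T.isAddHaarMeasure_map _
  have hTm : Measurable T := T.continuous.measurable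
  rw [stdGaussian_eq_withDensity ((Measure.addHaar : Measure E).map T)]
  ext s hs
  rw [Measure.map_apply hTm hs, stdGaussianLaw, withDensity_apply _ (hTm hs),
    withDensity_apply _ hs, setLIntegral_map hs (measurable_gaussDensity _).ennreal_ofReal hTm]
  simp only [one_div_kappa_mul_gaussWeight hT]

lemma map_comp_eq_stdGaussian (hT : ∀ x y, inner ℝ (T x) (T y) = B x y) {Ω : Type*}
    [MeasurableSpace Ω] {P : Measure Ω} {U : Ω → E} (hU : AEMeasurable U P)
    (hlaw : P.map U = stdGaussianLaw B) : P.map (fun ω => T (U ω)) = stdGaussian F := by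
  rw [← map_stdGaussianLaw hT, ← hlaw]
  exact (AEMeasurable.map_map_of_aemeasurable T.continuous.aemeasurable hU).symm

lemma kappa_pos (hT : ∀ x y, inner ℝ (T x) (T y) = B x y) : 0 < kappa B := by
  have : ((Measure.addHaar : Measure E).map T).IsAddHaarMeasure := T.isAddHaarMeasure_map _
  rw [kappa_eq hT]
  exact integral_exp_pos (integrable_exp_neg_half_sq_norm _)

lemma smoothed_eq (hT : ∀ x y, inner ℝ (T x) (T y) = B x y) (f : E → ℝ) (μ : ℝ) :
    smoothed B f μ = gaussSmooth (f ∘ T.symm) μ ∘ T := by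
  have : ((Measure.addHaar : Measure E).map T).IsAddHaarMeasure := T.isAddHaarMeasure_map _
  ext x
  rw [Function.comp_apply, gaussSmooth,
    stdGaussian_eq_withDensity ((Measure.addHaar : Measure E).map T),
    integral_withDensity_ofReal (measurable_gaussDensity _) (gaussDensity_nonneg _),
    integral_map_addHaar, smoothed, ← integral_const_mul]
  congr 1 with u
  rw [← one_div_kappa_mul_gaussWeight hT, Function.comp_apply, map_add, map_smul,
    T.symm_apply_apply, T.symm_apply_apply, smul_eq_mul]
  ring

lemma integrable_comp_add_smul_mul_gaussWeight (hT : ∀ x y, inner ℝ (T x) (T y) = B x y)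
    {f : E → ℝ} {μ : ℝ} {y : E}
    (hf : Integrable (fun z => (f ∘ T.symm) (T y + μ • z)) (stdGaussian F)) :
    Integrable (fun v => f (y + μ • v) * gaussWeight B v) Measure.addHaar := by
  have : ((Measure.addHaar : Measure E).map T).IsAddHaarMeasure := T.isAddHaarMeasure_map _
  rw [stdGaussian_eq_withDensity ((Measure.addHaar : Measure E).map T),
    integrable_withDensity_ofReal_iff (measurable_gaussDensity _) (gaussDensity_nonneg _)] at hf
  refine ((hf.comp_measurable T.continuous.measurable).const_mul (kappa B)).congr
    (.of_forall fun v => ?_)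
  have hκ := (kappa_pos hT).ne'
  simp only [Function.comp_apply, ← one_div_kappa_mul_gaussWeight hT, map_add, map_smul,
    T.symm_apply_apply, smul_eq_mul]
  field_simp

lemma dualNorm_fderiv_smoothed (hT : ∀ x y, inner ℝ (T x) (T y) = B x y) (f : E → ℝ) (μ : ℝ)
    (x : E) : dualNorm B (fderiv ℝ (smoothed B f μ) x) =
      ‖fderiv ℝ (gaussSmooth (f ∘ T.symm) μ) (T x)‖ := by
  rw [smoothed_eq hT, T.comp_right_fderiv, dualNorm_eq_norm hT]
  congr 1
  ext z
  simp

end Transfer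

end ZerothOrder

theorem lemma3p1
    {E : Type*} [NormedAddCommGroup E] [NormedSpace ℝ E] [FiniteDimensional ℝ E]
    [MeasurableSpace E] [BorelSpace E]
    (n : ℕ) (hn : Module.finrank ℝ E = n)
    -- the Euclidean structure
    (B : E ≃L[ℝ] StrongDual ℝ E)
    (hBsymm : ∀ x y : E, B x y = B y x) (hBpos : ∀ x : E, x ≠ 0 → 0 < B x x)
    -- the objective: differentiable with Hölder continuous gradient, with finite optimal value
    (f : E → ℝ) (ν L : ℝ) (hν0 : 0 ≤ ν) (hν1 : ν ≤ 1) (hL : 0 ≤ L)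
    (hf : Differentiable ℝ f)
    (hHolder : ∀ x y : E, ZerothOrder.dualNorm B (fderiv ℝ f y - fderiv ℝ f x) ≤
      L * ZerothOrder.primalNorm B (y - x) ^ ν)
    (fstar : ℝ) (hfstar : IsGLB (Set.range f) fstar)
    -- the inexact zeroth-order oracle
    (δ : ℝ) (hδ : 0 ≤ δ) (ftilde : E → ℝ) (hft_meas : Measurable ftilde)
    (hft : ∀ x : E, |f x - ftilde x| ≤ δ)
    -- the parameters
    (μ : ℝ) (hμ : 0 < μ) (D : ℝ) (hD0 : 0 < D) (hD1 : D ≤ 1)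
    (A₁ A₂ A₁' A₂' : ℝ)
    (hA : ZerothOrder.IsSlackPair n ν L μ A₁ A₂)
    (hA' : ZerothOrder.IsSlackPair n ν L μ A₁' A₂')
    (hA₁ : 0 < A₁)
    (h : ℝ) (hh : h = D / (80 * ((n : ℝ) + 4) * A₁))
    -- the random directions and the process
    {Ω : Type*} [MeasurableSpace Ω] (P : Measure Ω) [IsProbabilityMeasure P]
    (N : ℕ) (hN : 0 < N) (u : Fin N → Ω → E)
    (hu_meas : ∀ k, Measurable (u k))
    (hu_law : ∀ k, P.map (u k) = ZerothOrder.stdGaussianLaw B)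
    (hu_indep : iIndepFun u P)
    (x₀ : E) (x : ℕ → Ω → E) (hx_zero : ∀ ω, x 0 ω = x₀)
    (hx_succ : ∀ (k : Fin N) (ω : Ω), x ((k : ℕ) + 1) ω =
      x k ω - h • B.symm (ZerothOrder.gradEst B ftilde μ (x k ω) (u k ω))) :
    -- `f_μ` is well defined and differentiable, and the expectations are finite
    (∀ y : E, Integrable (fun v => f (y + μ • v) * ZerothOrder.gaussWeight B v)
      Measure.addHaar) ∧
    Differentiable ℝ (ZerothOrder.smoothed B f μ) ∧
    (∀ k : ℕ, k < N → Integrable (fun ω =>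
      ZerothOrder.dualNorm B (fderiv ℝ (ZerothOrder.smoothed B f μ) (x k ω)) ^ 2) P) ∧
    -- the bound
    (Finset.range N).inf' (Finset.nonempty_range_iff.mpr hN.ne') (fun k =>
        ∫ ω, ZerothOrder.dualNorm B (fderiv ℝ (ZerothOrder.smoothed B f μ) (x k ω)) ^ 2 ∂P) ≤
      320 * ((n : ℝ) + 4) * A₁ * (ZerothOrder.smoothed B f μ x₀ - fstar) / (N * D)
      + D / (4 * ((n : ℝ) + 4)) *
        (4 * δ ^ 2 / μ ^ 2 * n
          + 4 * L ^ 2 / (1 + ν) ^ 2 * μ ^ (2 * ν) * (n : ℝ) ^ (2 + ν)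
          + μ ^ 2 * A₁' ^ 2 / 4 * ((n : ℝ) + 6) ^ 3
          + A₂' ^ 2 / μ ^ 2 * n)
      + 320 * ((n : ℝ) + 4) * A₁ / D *
        (A₂ + δ ^ 2 / (2 * A₁ * μ ^ 2) * n + δ ^ 2 / μ ^ 2 * n) := by
  lift ν to ℝ≥0 using hν0
  lift L to ℝ≥0 using hL
  obtain ⟨T, hT⟩ := ZerothOrder.exists_continuousLinearEquiv_euclideanSpace hBsymm hBpos
  have hTm : Measurable T := T.continuous.measurable
  have hd : Differentiable ℝ (f ∘ T.symm) := hf.comp T.symm.differentiable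
  have hf' := ZerothOrder.holderWith_fderiv_comp_symm hT hHolder
  have hgrowth := ZerothOrder.HasPolynomialGrowth.of_fderiv hd (.of_holderWith hf')
  have hft' (z) : |(f ∘ T.symm) z - (ftilde ∘ T.symm) z| ≤ δ := hft (T.symm z)
  have hft_meas' : Measurable (ftilde ∘ T.symm) := hft_meas.comp T.symm.continuous.measurable
  have hx := ZerothOrder.isDrivenBy_gradStep_of_gradEst (T := T) hx_zero hx_succ
  have hu_meas' (k : Fin N) : Measurable fun ω => T (u k ω) := hTm.comp (hu_meas k)
  have hu_law' (k : Fin N) := ZerothOrder.map_comp_eq_stdGaussian hT (hu_meas k).aemeasurable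
    (hu_law k)
  simp only [ZerothOrder.dualNorm_fderiv_smoothed hT]
  rw [ZerothOrder.smoothed_eq hT]
  refine ⟨fun y => ZerothOrder.integrable_comp_add_smul_mul_gaussWeight hT
      (hgrowth.hasFiniteMoments_comp_add_smul hd.continuous.stronglyMeasurable μ _).integrable,
    (ZerothOrder.differentiable_gaussSmooth hd (.of_holderWith hf') μ).comp T.differentiable,
    fun k hk => hx.integrable_norm_fderiv_gaussSmooth_sq hd hf' (hgrowth.of_norm_sub_le hft')
      hft_meas' (fun j => .of_map_eq_stdGaussian (hu_meas' j).aemeasurable (hu_law' j)) hk.le,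
    hx.inf'_integral_norm_fderiv_gaussSmooth_sq_le hd hf' hν1
      (fun z => hfstar.1 (Set.mem_range_self (T.symm z))) hft_meas' hft' hμ
      (finrank_euclideanSpace_fin.trans hn) hA hA' hA₁ hD0 hD1 hh hN hu_meas' hu_law'
      (hu_indep.comp (fun _ => T) fun _ => hTm)⟩
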